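/- Let $k$ be a field and let $\mathcal T$ be a $k$-linear triangulated category. For $\mathcal S\subset\mathcal T$ let $\langle\mathcal S\rangle\subset\mathcal T$ denote the strictly full triangulated subcategory generated by $\mathcal S$. Let $\mathrm{st}(\mathcal T)$ be the set of locally finite Bridgeland stability conditions $(\mathcal P,Z)$ on $\mathcal T$, with slicing $\{\mathcal P(t)\}_{t\in\mathbb R}$ and central charge $Z:K(\mathcal T)\to\mathbb C$. A *full Ext-exceptional collection* in $\mathcal T$ is a sequence $\mathcal E=(E_0,\dots,E_n)$ of objects such that $\mathrm{Hom}(E_a,E_a)=k$; $\mathrm{Hom}(E_a,E_a[l])=0$ for $l\neq0$; $\mathrm{Hom}(E_a,E_b[l])=0$ for $a>b$ and all $l\in\mathbb Z$; $\mathrm{Hom}(E_a,E_b[l])=0$ for $a\neq b$ and $l\le 0$; and $\langle\mathcal E\rangle=\mathcal T$. Its extension closure $\mathcal A_{\mathcal E}$ (the smallest strictly full subcategory that contains $0$ and all $E_a$ and is closed under extensions) is the heart of a bounded t-structure on $\mathcal T$. For a heart $\mathcal A\subset\mathcal T$ of a bounded t-structure, a *stability function* on $\mathcal A$ is a homomorphism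 $Z:K(\mathcal A)\to\mathbb C$ with $Z(X)\in\{r e^{i\pi t}: r>0,\ 0<t\le1\}$ for all nonzero $X\in\mathcal A$; for such $X$ let $\phi(X)\in(0,1]$ be the number with $Z(X)\in\mathbb R_{>0}e^{i\pi\phi(X)}$. A nonzero $X\in\mathcal A$ is $Z$-semistable if $\phi(X')\le\phi(X)$ for every nonzero subobject $X'$ of $X$ in $\mathcal A$, and $Z$ has the Harder–Narasimhan property if every nonzero object of $\mathcal A$ has a finite filtration with semistable quotients of strictly decreasing phases. Let $\mathbb H^{\mathcal A}\subset\mathrm{st}(\mathcal T)$ be the set of those $(\mathcal P,Z_e)$ for which there is a stability function $Z$ on $\mathcal A$ with the Harder–Narasimhan property such that $Z_e(X)=Z(X)$ for all $X\in\mathcal A$ and, for all $t\in(0,1]$, the objects of $\mathcal P(t)$ are the zero objects and the $Z$-semistable objects of $\mathcal A$ of phase $t$. Write $\mathbb H^{\mathcal E}=\mathbb H^{\mathcal A_{\mathcal E}}$. **Proposition.** Let $\mathcal E=(E_0,\dots,E_n)$ be a full Ext-exceptional collection in $\mathcal T$, let $0\le i<j\le n$, and put $\mathcal E_{ij}=(E_i,E_{i+1},\dots,E_j)$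 and $\mathcal T_{ij}=\langle\mathcal E_{ij}\rangle$, so that $\mathcal E_{ij}$ is a full Ext-exceptional collection in $\mathcal T_{ij}$ and $\mathbb H^{\mathcal E_{ij}}\subset\mathrm{st}(\mathcal T_{ij})$. Then for each $(\mathcal P,Z)\in\mathbb H^{\mathcal E}$ there is a unique $(\mathcal P',Z')\in\mathbb H^{\mathcal E_{ij}}$ with $Z'(E_a)=Z(E_a)$ for all $i\le a\le j$, and the resulting map $\pi_{ij}:\mathbb H^{\mathcal E}\to\mathbb H^{\mathcal E_{ij}}$, $(\mathcal P,Z)\mapsto(\mathcal P',Z')$, is surjective. Moreover, if $\pi_{ij}(\mathcal P,Z)=(\mathcal P',Z')$, then $\mathcal P'(t)=\mathcal P(t)\cap\mathcal T_{ij}$ for all $t\in\mathbb R$. -/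

import Mathlib

open CategoryTheory CategoryTheory.Limits CategoryTheory.Pretriangulated

namespace BridgelandStability

universe w v u

section Abelian

/-! ### Stability functions on an abelian category

The category `A` will be (the full subcategory given by) the heart of a bounded t-structure, which
is abelian. The notions below only refer to the preadditive structure. -/

variable (A : Type u) [Category.{v} A] [Preadditive A]

/-- Relations of the Grothendieck group of an abelian category: one for each short exact
sequence. -/
def abRelations : AddSubgroup (FreeAbelianGroup A) :=
  AddSubgroup.closure {x | ∃ S : ShortComplex A, S.ShortExact ∧
    x = FreeAbelianGroup.of S.X₂ - FreeAbelianGroup.of S.X₁ - FreeAbelianGroup.of S.X₃}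

/-- The Grothendieck group `K(A)` of an abelian category. -/
abbrev AbK : Type u := FreeAbelianGroup A ⧸ abRelations A

variable {A}

/-- The class `[X] ∈ K(A)`. -/
def AbK.cls (X : A) : AbK A := QuotientAddGroup.mk (FreeAbelianGroup.of X)

/-- The half plane `{r exp(iπt) : r > 0, 0 < t ≤ 1}`. -/
def halfPlane : Set ℂ :=
  {z | ∃ r t : ℝ, 0 < r ∧ 0 < t ∧ t ≤ 1 ∧
    z = (r : ℂ) * Complex.exp (((Real.pi * t : ℝ) : ℂ) * Complex.I)}

/-- A stability function: nonzero objects have values in the half plane. -/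
def IsStabilityFunction (Z : AbK A →+ ℂ) : Prop :=
  ∀ X : A, ¬ IsZero X → Z (AbK.cls X) ∈ halfPlane

/-- The phase of an object with respect to `Z`; if `Z` is a stability function and `X` is nonzero,
this is the number `t ∈ (0, 1]` with `Z(X) ∈ ℝ_{>0} exp(iπt)`. -/
noncomputable def phase (Z : AbK A →+ ℂ) (X : A) : ℝ :=
  Complex.arg (Z (AbK.cls X)) / Real.pi

/-- A nonzero object is semistable if the phase of every nonzero subobject is at most its phase. -/
def IsSemistable (Z : AbK A →+ ℂ) (X : A) : Prop :=
  ¬ IsZero X ∧ ∀ (X' : A) (f : X' ⟶ X), Mono f → ¬ IsZero X' → phase Z X' ≤ phase Z X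

/-- The Harder-Narasimhan property: every nonzero object has a finite filtration with semistable
quotients of strictly decreasing phases. -/
def HasHNProperty (Z : AbK A →+ ℂ) : Prop :=
  ∀ X : A, ¬ IsZero X → ∃ (n : ℕ) (B : Fin (n + 1) → A) (F : Fin n → A),
    IsZero (B 0) ∧ Nonempty (B (Fin.last n) ≅ X) ∧
    (∀ a : Fin n, ∃ (f : B a.castSucc ⟶ B a.succ) (g : B a.succ ⟶ F a) (h : f ≫ g = 0),
      (ShortComplex.mk f g h).ShortExact) ∧
    (∀ a : Fin n, IsSemistable Z (F a)) ∧ StrictAnti (fun a : Fin n => phase Z (F a))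

/-- A strict monomorphism, i.e. a kernel of some morphism. -/
def IsStrictMono {X Y : A} (f : X ⟶ Y) : Prop := Nonempty (NormalMono f)

variable (A) in
/-- A (quasi-abelian) category is of finite length if every object satisfies the ascending and
descending chain conditions on strict subobjects. -/
def IsFiniteLengthCategory : Prop :=
  ∀ X : A, WellFoundedLT {S : Subobject X // IsStrictMono S.arrow} ∧
    WellFoundedGT {S : Subobject X // IsStrictMono S.arrow}

end Abelian

section Triangulated

/-! ### Triangulated categories and stability conditions on them -/

variable {C : Type u} [Category.{v} C] [Preadditive C] [HasZeroObject C] [HasShift C ℤ]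
  [∀ m : ℤ, (shiftFunctor C m).Additive] [Pretriangulated C]

/-- The extension closure of `P`: the smallest full subcategory that contains `P` and the zero
objects, and contains `X₂` for each triangle `X₁ ⟶ X₂ ⟶ X₃ ⟶ X₁⟦1⟧` whose ends it contains.
(It is closed under isomorphisms, as `X ⟶ Y ⟶ 0 ⟶ X⟦1⟧` is a triangle if `X ≅ Y`.) -/
inductive extensionClosure (P : ObjectProperty C) : ObjectProperty C
  | of (X : C) (hX : P X) : extensionClosure P X
  | zero (X : C) (hX : IsZero X) : extensionClosure P X
  | ext (T : Triangle C) (hT : T ∈ distTriang C) (h₁ : extensionClosure P T.obj₁)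
      (h₃ : extensionClosure P T.obj₃) : extensionClosure P T.obj₂

/-- The strictly full triangulated subcategory generated by `P`. (It need not be closed under
direct summands; it is closed under isomorphisms, as `extensionClosure` is.) -/
inductive triangulatedHull (P : ObjectProperty C) : ObjectProperty C
  | of (X : C) (hX : P X) : triangulatedHull P X
  | zero (X : C) (hX : IsZero X) : triangulatedHull P X
  | shift (X : C) (a : ℤ) (hX : triangulatedHull P X) : triangulatedHull P (X⟦a⟧)
  | ext (T : Triangle C) (hT : T ∈ distTriang C) (h₁ : triangulatedHull P T.obj₁)
      (h₃ : triangulatedHull P T.obj₃) : triangulatedHull P T.obj₂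

instance (P : ObjectProperty C) : (triangulatedHull P).IsTriangulated where
  exists_zero := (HasZeroObject.zero (C := C)).imp fun _ h => ⟨h, triangulatedHull.zero _ h⟩
  isStableUnderShiftBy a := ⟨fun X hX => triangulatedHull.shift X a hX⟩
  ext₂' T hT h₁ h₃ := ⟨T.obj₂, triangulatedHull.ext T hT h₁ h₃, ⟨Iso.refl _⟩⟩

variable (C) in
/-- Relations of the Grothendieck group of a triangulated category: one for each distinguished
triangle. -/
def triRelations : AddSubgroup (FreeAbelianGroup C) :=
  AddSubgroup.closure {x | ∃ T : Triangle C, T ∈ distTriang C ∧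
    x = FreeAbelianGroup.of T.obj₂ - FreeAbelianGroup.of T.obj₁ - FreeAbelianGroup.of T.obj₃}

variable (C) in
/-- The Grothendieck group `K(C)` of a triangulated category. -/
abbrev TriK : Type u := FreeAbelianGroup C ⧸ triRelations C

/-- The class `[X] ∈ K(C)`. -/
def TriK.cls (X : C) : TriK C := QuotientAddGroup.mk (FreeAbelianGroup.of X)

/-- The subcategory `P(I)`: the extension closure of the `P(t)`, `t ∈ I`. -/
def intervalSubcategory (P : ℝ → ObjectProperty C) (I : Set ℝ) : ObjectProperty C :=
  extensionClosure (fun X => ∃ t ∈ I, P t X)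

variable (C) in
/-- The set `st(C)` of locally finite Bridgeland stability conditions `(P, Z)` on `C`. -/
@[ext]
structure StabilityCondition where
  /-- the slicing -/
  P : ℝ → ObjectProperty C
  /-- the central charge -/
  Z : TriK C →+ ℂ
  /-- each `P t` is a strictly full additive subcategory -/
  closedUnderIso (t : ℝ) : (P t).IsClosedUnderIsomorphisms
  closedUnderSums (t : ℝ) : (P t).IsClosedUnderFiniteProducts
  /-- `P(t)[1] = P(t + 1)` -/
  shift_iff (t : ℝ) (X : C) : P (t + 1) (X⟦(1 : ℤ)⟧) ↔ P t X
  hom_eq_zero (t₁ t₂ : ℝ) (h : t₂ < t₁) (X₁ X₂ : C) (h₁ : P t₁ X₁) (h₂ : P t₂ X₂)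
    (f : X₁ ⟶ X₂) : f = 0
  /-- Harder-Narasimhan filtrations -/
  exists_HN (X : C) (hX : ¬ IsZero X) : ∃ (n : ℕ) (B : Fin (n + 1) → C) (F : Fin n → C)
    (φ : Fin n → ℝ), IsZero (B 0) ∧ Nonempty (B (Fin.last n) ≅ X) ∧
    (∀ a : Fin n, ∃ (f : B a.castSucc ⟶ B a.succ) (g : B a.succ ⟶ F a)
      (h : F a ⟶ (B a.castSucc)⟦(1 : ℤ)⟧), Triangle.mk f g h ∈ distTriang C) ∧
    (∀ a : Fin n, P (φ a) (F a) ∧ ¬ IsZero (F a)) ∧ StrictAnti φ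
  central_charge (t : ℝ) (X : C) (hX : P t X) (h0 : ¬ IsZero X) : ∃ r : ℝ, 0 < r ∧
    Z (TriK.cls X) = (r : ℂ) * Complex.exp (((Real.pi * t : ℝ) : ℂ) * Complex.I)
  locallyFinite : ∃ η : ℝ, 0 < η ∧ η < 1 / 2 ∧ ∀ t : ℝ,
    IsFiniteLengthCategory (intervalSubcategory P (Set.Ioo (t - η) (t + η))).FullSubcategory

/-- The family `ℍ^A ⊆ st(C)` attached to the heart `A` of a bounded t-structure: the stability
conditions that come from a stability function with the Harder-Narasimhan property on `A`. -/
def heartFamily (A : ObjectProperty C) : Set (StabilityCondition C) :=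
  {σ | ∃ Z : AbK A.FullSubcategory →+ ℂ, IsStabilityFunction Z ∧ HasHNProperty Z ∧
    (∀ X : A.FullSubcategory, σ.Z (TriK.cls X.obj) = Z (AbK.cls X)) ∧
    ∀ t : ℝ, 0 < t → t ≤ 1 → ∀ X : C, σ.P t X ↔
      ∃ hX : A X, IsZero X ∨ (IsSemistable Z ⟨X, hX⟩ ∧ phase Z ⟨X, hX⟩ = t)}

/-- The family `ℍ^E`, for the extension closure of a collection `E`. -/
def collectionFamily {ι : Type*} (E : ι → C) : Set (StabilityCondition C) :=
  heartFamily (extensionClosure (ObjectProperty.ofObj E))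

/-- The triangulated subcategory `⟨E⟩` generated by a collection `E`. -/
abbrev generated {ι : Type*} (E : ι → C) : ObjectProperty C :=
  triangulatedHull (ObjectProperty.ofObj E)

/-- The collection `E`, regarded as a collection in the triangulated category `⟨E⟩`. -/
def toGenerated {ι : Type*} (E : ι → C) (a : ι) : (generated E).FullSubcategory :=
  ⟨E a, triangulatedHull.of _ ⟨a⟩⟩

/-- The part `(E_i, E_{i+1}, …, E_j)` of a collection `(E_0, …, E_n)`. -/
def subcollection {n : ℕ} (E : Fin (n + 1) → C) (i j : Fin (n + 1)) : Set.Icc i j → C :=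
  fun a => E a

/-- A full Ext-exceptional collection in a `k`-linear triangulated category. -/
structure IsFullExtExceptional (k : Type w) [Field k] [Linear k C] {n : ℕ}
    (E : Fin (n + 1) → C) : Prop where
  /-- `Hom(E_a, E_a) = k` -/
  end_eq (a : Fin (n + 1)) : Module.finrank k (E a ⟶ E a) = 1
  /-- `Hom^l(E_a, E_a) = 0` for `l ≠ 0` -/
  self_ext (a : Fin (n + 1)) (l : ℤ) (hl : l ≠ 0) (f : E a ⟶ (E a)⟦l⟧) : f = 0
  /-- `Hom^l(E_a, E_b) = 0` for `a > b` and all `l` -/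
  exceptional (a b : Fin (n + 1)) (h : b < a) (l : ℤ) (f : E a ⟶ (E b)⟦l⟧) : f = 0
  /-- `Hom^l(E_a, E_b) = 0` for `a ≠ b` and `l ≤ 0` -/
  ext (a b : Fin (n + 1)) (h : a ≠ b) (l : ℤ) (hl : l ≤ 0) (f : E a ⟶ (E b)⟦l⟧) : f = 0
  /-- the collection generates the triangulated category -/
  full : generated E = ⊤

end Triangulated

end BridgelandStability

open BridgelandStability

namespace BridgelandStability

open ObjectProperty ZeroObject

universe w w' v v' u u'

set_option linter.unusedSectionVars false

/-! ### Extension closures and products of extensions. -/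

section ExtensionClosure

variable {C : Type u} [Category.{v} C] [Preadditive C] [HasZeroObject C] [HasShift C ℤ]
  [∀ m : ℤ, (shiftFunctor C m).Additive] [Pretriangulated C]

/-! A point of `collectionFamily E` is the same thing as a choice of numbers `Z(E_a)` in the half
plane. Under this identification the restriction map forgets the coordinates outside `[i, j]`, which
makes it well defined and surjective. The comparison of slicings holds because the small heart is
closed under subobjects and quotients in the large one.

Two properties of the collection carry the argument. First, it is simple-minded
(`IsFullExtExceptional.isSimpleMinded`): there are no negative extensions, and a morphism between
members is zero or invertible. Extensions of shifted members can then be sorted by decreasing shift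
(`extensionClosure_shiftsIn_union_le`). This makes the heart abelian (`admissibleMorphism_eq_top`)
and filters every object by shifts of objects of the heart.

Second, the classes of the members are independent in the Grothendieck group. The coordinate `rk_a`
is the Euler characteristic of `Hom(E_a, -)`, applied to the component of an object in `⟨E_b : b ≤
a⟩` (`exists_multiplicity`, `exists_extend_additive`, `eulerChar_of_distTriang`). The coordinates
are nonnegative on the heart, and their sum is a positive length function.

Given a charge with all `Z(E_a)` in the half plane, objects of bounded length have only finitely
many charges. Harder–Narasimhan filtrations therefore exist in the heart (`exists_hasFiltration`),
and splicing them over the shifts gives those of the triangulated category. Finitely many members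
give a positive lower bound for all phases in the heart, so a short interval subcategory embeds into
one shift of the heart, where length bounds chains (`slicing_locallyFinite`). A stability condition
on a fixed heart is determined by its charge (`eq_of_mem_heartFamily`), so `stabilityOfCharge` gives
all of them.

For restriction, an object of the large heart lies in the small one exactly when its coordinates
outside the part vanish (`IsRankFunction.heart_iff` and `heart_of_eq_zero`). Coordinates are
nonnegative and additive, so subobjects and quotients inherit this, and semistability means the same
in both hearts (`isSemistable_toGenerated_iff`). -/

lemma distinguished_mk_of_iso {X Y Z X' Y' Z' : C} {f : X ⟶ Y} {g : Y ⟶ Z} {h : Z ⟶ X⟦(1 : ℤ)⟧}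
    (hT : Triangle.mk f g h ∈ distTriang C) {f' : X' ⟶ Y'} {g' : Y' ⟶ Z'} {h' : Z' ⟶ X'⟦(1 : ℤ)⟧}
    (a : X' ≅ X) (b : Y' ≅ Y) (c : Z' ≅ Z) (h₁ : f' ≫ b.hom = a.hom ≫ f)
    (h₂ : g' ≫ c.hom = b.hom ≫ g) (h₃ : h' ≫ a.hom⟦1⟧' = c.hom ≫ h) :
    Triangle.mk f' g' h' ∈ distTriang C :=
  isomorphic_distinguished _ hT _ (Triangle.isoMk _ _ a b c h₁ h₂ h₃)

lemma extensionClosure_of_iso (P : ObjectProperty C) {X Y : C} (e : X ≅ Y)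
    (hX : extensionClosure P X) : extensionClosure P Y := by
  refine extensionClosure.ext (Triangle.mk e.hom (0 : Y ⟶ 0) 0) ?_ hX
    (extensionClosure.zero _ (isZero_zero C))
  exact distinguished_mk_of_iso (contractible_distinguished X) (Iso.refl _) e.symm (Iso.refl _)
    (by simp) (by simp) (by simp)

instance (P : ObjectProperty C) : (extensionClosure P).IsClosedUnderIsomorphisms where
  of_iso e hX := extensionClosure_of_iso P e hX

instance (P : ObjectProperty C) : (extensionClosure P).ContainsZero where
  exists_zero := ⟨0, isZero_zero C, extensionClosure.zero _ (isZero_zero C)⟩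

instance (P : ObjectProperty C) : (extensionClosure P).IsTriangulatedClosed₂ :=
  .mk' fun T hT h₁ h₃ => extensionClosure.ext T hT h₁ h₃

lemma le_extensionClosure (P : ObjectProperty C) : P ≤ extensionClosure P :=
  fun X hX => extensionClosure.of X hX

lemma extensionClosure_le {P Q : ObjectProperty C} [Q.ContainsZero] [Q.IsClosedUnderIsomorphisms]
    (h : P ≤ Q) (hQ : extensionProduct Q Q ≤ Q) : extensionClosure P ≤ Q := by
  intro X hX
  induction hX with
  | of X hX => exact h _ hX
  | zero X hX => exact Q.prop_of_isZero hX
  | ext T hT h₁ h₃ ih₁ ih₃ => exact hQ _ ⟨_, _, _, _, _, hT, ih₁, ih₃⟩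

lemma extensionProduct_extensionClosure_le (P : ObjectProperty C) :
    extensionProduct (extensionClosure P) (extensionClosure P) ≤ extensionClosure P :=
  extensionProduct_le_of_isTriangulatedClosed₂ le_rfl le_rfl

lemma extensionClosure_mono {P Q : ObjectProperty C} (h : P ≤ Q) :
    extensionClosure P ≤ extensionClosure Q :=
  extensionClosure_le (h.trans (le_extensionClosure Q)) (extensionProduct_extensionClosure_le Q)

lemma extensionClosure_shift {P Q : ObjectProperty C} (a : ℤ)
    (h : ∀ X, P X → extensionClosure Q (X⟦a⟧)) {X : C} (hX : extensionClosure P X) :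
    extensionClosure Q (X⟦a⟧) := by
  induction hX with
  | of X hX => exact h _ hX
  | zero X hX => exact .zero _ (Functor.map_isZero _ hX)
  | ext T hT h₁ h₃ ih₁ ih₃ => exact .ext _ (Triangle.shift_distinguished _ hT a) ih₁ ih₃

lemma iso_of_extensionProduct_isZero_left {P Q : ObjectProperty C}
    [Q.IsClosedUnderIsomorphisms] (hP : ∀ X, P X → IsZero X) :
    extensionProduct P Q ≤ Q := by
  rintro X ⟨Y, Z, f, g, h, hT, hY, hZ⟩
  have : IsIso g := (Triangle.isZero₁_iff_isIso₂ _ hT).1 (hP _ hY)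
  exact Q.prop_of_iso (asIso g).symm hZ

lemma iso_of_extensionProduct_isZero_right {P Q : ObjectProperty C}
    [P.IsClosedUnderIsomorphisms] (hQ : ∀ X, Q X → IsZero X) :
    extensionProduct P Q ≤ P := by
  rintro X ⟨Y, Z, f, g, h, hT, hY, hZ⟩
  have : IsIso f := (Triangle.isZero₃_iff_isIso₁ _ hT).1 (hQ _ hZ)
  exact P.prop_of_iso (asIso f) hY

lemma extensionProduct_mono {P P' Q Q' : ObjectProperty C} (h : P ≤ P') (h' : Q ≤ Q') :
    extensionProduct P Q ≤ extensionProduct P' Q' :=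
  (monotone_extensionProduct_left _ h).trans (monotone_extensionProduct_right _ h')

/-! ### Reordering the factors of iterated extensions. -/

section Sorting

variable [IsTriangulated C] {P Q : ObjectProperty C}

/-- If the extensions of an object of `P` by an object of `Q` in the wrong order can be rewritten
in the right order, without increasing the number of objects of `Q`, then so can the extensions of
objects of `extensionClosure P`. -/
lemma extensionProduct_swap_left {Q₀ : ObjectProperty C} [Q₀.IsClosedUnderIsomorphisms]
    [Q₀.ContainsZero]
    (h : extensionProduct Q₀ P ≤ extensionProduct (extensionClosure P) Q₀) :
    extensionProduct Q₀ (extensionClosure P) ≤ extensionProduct (extensionClosure P) Q₀ := by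
  suffices H : ∀ Z, extensionClosure P Z →
      extensionProduct Q₀ (ObjectProperty.singleton Z) ≤
        extensionProduct (extensionClosure P) Q₀ by
    rintro X ⟨Y, Z, f, g, k, hT, hY, hZ⟩
    exact H Z hZ X ⟨Y, Z, f, g, k, hT, hY, by simp⟩
  intro Z hZ
  induction hZ with
  | of X hX =>
    refine le_trans (monotone_extensionProduct_right _ ?_) h
    rintro Y hY
    obtain rfl : X = Y := by simpa using hY
    exact hX
  | zero X hX =>
    refine (iso_of_extensionProduct_isZero_right ?_).trans (le_extensionProduct_right _)
    rintro Y hY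
    obtain rfl : X = Y := by simpa using hY
    exact hX
  | ext T hT h₁ h₃ ih₁ ih₃ =>
    have h₂ : ObjectProperty.singleton T.obj₂ ≤
        extensionProduct (ObjectProperty.singleton T.obj₁) (ObjectProperty.singleton T.obj₃) := by
      intro Y hY
      obtain rfl : T.obj₂ = Y := by simpa using hY
      exact ⟨_, _, _, _, _, hT, by simp, by simp⟩
    -- Associativity of the extension product is the octahedral axiom. The factor from `Q₀` moves
    -- past the two ends of `Z` one after the other and stays a single factor.
    calc _ ≤ _ := monotone_extensionProduct_right _ h₂
      _ = _ := (extensionProduct_assoc _ _ _).symm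
      _ ≤ _ := monotone_extensionProduct_left _ ih₁
      _ = _ := extensionProduct_assoc _ _ _
      _ ≤ _ := monotone_extensionProduct_right _ ih₃
      _ = _ := (extensionProduct_assoc _ _ _).symm
      _ ≤ _ := monotone_extensionProduct_left _ (extensionProduct_extensionClosure_le P)

lemma extensionProduct_swap_right {U : ObjectProperty C} [U.IsClosedUnderIsomorphisms]
    [U.ContainsZero]
    (h : extensionProduct Q U ≤ extensionProduct U (extensionClosure Q)) :
    extensionProduct (extensionClosure Q) U ≤ extensionProduct U (extensionClosure Q) := by
  suffices H : ∀ Z, extensionClosure Q Z →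
      extensionProduct (ObjectProperty.singleton Z) U ≤
        extensionProduct U (extensionClosure Q) by
    rintro X ⟨Y, Z, f, g, k, hT, hY, hZ⟩
    exact H Y hY X ⟨Y, Z, f, g, k, hT, by simp, hZ⟩
  intro Z hZ
  induction hZ with
  | of X hX =>
    refine le_trans (monotone_extensionProduct_left _ ?_) h
    rintro Y hY
    obtain rfl : X = Y := by simpa using hY
    exact hX
  | zero X hX =>
    refine (iso_of_extensionProduct_isZero_left ?_).trans (le_extensionProduct_left _)
    rintro Y hY
    obtain rfl : X = Y := by simpa using hY
    exact hX
  | ext T hT h₁ h₃ ih₁ ih₃ =>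
    have h₂ : ObjectProperty.singleton T.obj₂ ≤
        extensionProduct (ObjectProperty.singleton T.obj₁) (ObjectProperty.singleton T.obj₃) := by
      intro Y hY
      obtain rfl : T.obj₂ = Y := by simpa using hY
      exact ⟨_, _, _, _, _, hT, by simp, by simp⟩
    calc _ ≤ _ := monotone_extensionProduct_left _ h₂
      _ = _ := extensionProduct_assoc _ _ _
      _ ≤ _ := monotone_extensionProduct_right _ ih₃
      _ = _ := (extensionProduct_assoc _ _ _).symm
      _ ≤ _ := monotone_extensionProduct_left _ ih₁
      _ = _ := extensionProduct_assoc _ _ _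
      _ ≤ _ := monotone_extensionProduct_right _ (extensionProduct_extensionClosure_le Q)

/-- A factor of `Q` is first moved past a whole iterated extension of objects of `P`, and then an
iterated extension of objects of `Q` is moved. Zero objects are adjoined to `Q` because a factor of
`Q` may cancel against one of `P` instead of moving past it. -/
lemma extensionClosure_sup_le
    (h : extensionProduct (Q ⊔ IsZero) P ≤ extensionProduct (extensionClosure P) (Q ⊔ IsZero))
    [Q.IsClosedUnderIsomorphisms] :
    extensionClosure (P ⊔ Q) ≤ extensionProduct (extensionClosure P) (extensionClosure Q) := by
  have : (Q ⊔ IsZero).IsClosedUnderIsomorphisms :=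
    ⟨fun e hX => hX.imp (fun hX => Q.prop_of_iso e hX) (fun hX => hX.of_iso e.symm)⟩
  have : (Q ⊔ IsZero).ContainsZero := ⟨0, isZero_zero C, Or.inr (isZero_zero C)⟩
  have hQ : Q ⊔ IsZero ≤ extensionClosure Q :=
    sup_le (le_extensionClosure Q) (fun X hX => .zero X hX)
  have h₁ := extensionProduct_swap_left h
  have h₂ : extensionProduct (extensionClosure Q) (extensionClosure P) ≤
      extensionProduct (extensionClosure P) (extensionClosure Q) :=
    extensionProduct_swap_right ((monotone_extensionProduct_left _ le_sup_left).trans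
      (h₁.trans (monotone_extensionProduct_right _ hQ)))
  have : (extensionProduct (extensionClosure P) (extensionClosure Q)).ContainsZero :=
    ⟨0, isZero_zero C, le_extensionProduct_left (extensionClosure Q) _
      (extensionClosure.zero _ (isZero_zero C))⟩
  refine extensionClosure_le (sup_le ?_ ?_) ?_
  · exact (le_extensionClosure P).trans (le_extensionProduct_left _)
  · exact (le_extensionClosure Q).trans (le_extensionProduct_right _)
  · calc _ = extensionProduct (extensionClosure P) (extensionProduct
          (extensionProduct (extensionClosure Q) (extensionClosure P)) (extensionClosure Q)) := by
          simp only [extensionProduct_assoc]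
      _ ≤ extensionProduct (extensionClosure P) (extensionProduct
          (extensionProduct (extensionClosure P) (extensionClosure Q)) (extensionClosure Q)) :=
          monotone_extensionProduct_right _ (monotone_extensionProduct_left _ h₂)
      _ = extensionProduct (extensionProduct (extensionClosure P) (extensionClosure P))
          (extensionProduct (extensionClosure Q) (extensionClosure Q)) := by
          simp only [extensionProduct_assoc]
      _ ≤ _ := extensionProduct_mono (extensionProduct_extensionClosure_le P)
          (extensionProduct_extensionClosure_le Q)

end Sorting

lemma hom_eq_zero_of_extensionClosure_left {P : ObjectProperty C} {Y : C}
    (h : ∀ X, P X → ∀ f : X ⟶ Y, f = 0) {X : C} (hX : extensionClosure P X) (f : X ⟶ Y) :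
    f = 0 := by
  induction hX with
  | of X hX => exact h X hX f
  | zero X hX => exact hX.eq_of_src _ _
  | ext T hT h₁ h₃ ih₁ ih₃ =>
    obtain ⟨g, rfl⟩ := Triangle.yoneda_exact₂ T hT f (ih₁ _)
    rw [ih₃ g, comp_zero]

lemma hom_eq_zero_of_extensionClosure_right {P : ObjectProperty C} {X : C}
    (h : ∀ Y, P Y → ∀ f : X ⟶ Y, f = 0) {Y : C} (hY : extensionClosure P Y) (f : X ⟶ Y) :
    f = 0 := by
  induction hY with
  | of X hX => exact h X hX f
  | zero X hX => exact hX.eq_of_tgt _ _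
  | ext T hT h₁ h₃ ih₁ ih₃ =>
    obtain ⟨g, rfl⟩ := Triangle.coyoneda_exact₂ T hT f (ih₃ _)
    rw [ih₁ g, zero_comp]

lemma hom_eq_zero_of_extensionClosure {P Q : ObjectProperty C}
    (h : ∀ X Y, P X → Q Y → ∀ f : X ⟶ Y, f = 0) {X Y : C} (hX : extensionClosure P X)
    (hY : extensionClosure Q Y) (f : X ⟶ Y) : f = 0 :=
  hom_eq_zero_of_extensionClosure_left
    (fun _ hX g => hom_eq_zero_of_extensionClosure_right (fun _ hY => h _ _ hX hY) hY g) hX f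

end ExtensionClosure

/-! ### Simple-minded collections and their abelian hearts. -/

section SimpleMinded

variable {C : Type u} [Category.{v} C] [Preadditive C] [HasZeroObject C] [HasShift C ℤ]
  [∀ m : ℤ, (shiftFunctor C m).Additive] [Pretriangulated C]

lemma isClosedUnderFiniteProducts_of_isTriangulatedClosed₂ (P : ObjectProperty C)
    [P.ContainsZero] [P.IsClosedUnderIsomorphisms] [P.IsTriangulatedClosed₂] :
    P.IsClosedUnderFiniteProducts := by
  have : P.IsClosedUnderBinaryProducts := ⟨by
    rintro X ⟨p⟩
    refine P.prop_of_iso ?_ (P.ext_of_isTriangulatedClosed₂ _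
      (binaryProductTriangle_distinguished _ _)
      (p.prop_diag_obj (.mk .left)) (p.prop_diag_obj (.mk .right)))
    exact IsLimit.conePointUniqueUpToIso (prodIsProd _ _)
      ((IsLimit.postcomposeHomEquiv (diagramIsoPair p.diag) _).2 p.isLimit)⟩
  exact .mk'

lemma isZero_fullSubcategory_iff (P : ObjectProperty C) (X : P.FullSubcategory) :
    IsZero X ↔ IsZero X.obj :=
  ⟨fun h => P.ι.map_isZero h, fun h => IsZero.of_full_of_faithful_of_isZero P.ι X h⟩

lemma hom_shift_eq_zero {X Y : C} {m l n : ℤ} (hn : n + m = l) (h : ∀ f : X ⟶ Y⟦n⟧, f = 0)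
    (f : X⟦m⟧ ⟶ Y⟦l⟧) : f = 0 := by
  obtain ⟨g, hg⟩ := (shiftFunctor C m).map_surjective (f ≫ (shiftFunctorAdd' C n m l hn).hom.app Y)
  rw [h g, Functor.map_zero] at hg
  rw [← cancel_mono ((shiftFunctorAdd' C n m l hn).hom.app Y), ← hg, zero_comp]

/-- A simple-minded collection: there are no negative extensions, every morphism between two
members is zero or invertible, and the collection generates the triangulated category. -/
structure IsSimpleMinded {ι : Type w} (S : ι → C) : Prop where
  hom_neg (a b : ι) (l : ℤ) (hl : l < 0) (f : S a ⟶ (S b)⟦l⟧) : f = 0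
  eq_zero_or_isIso (a b : ι) (f : S a ⟶ S b) : f = 0 ∨ IsIso f
  full : generated S = ⊤

/-- The shifts of the objects of a collection by the elements of `I`. -/
def shiftsIn {ι : Type w} (S : ι → C) (I : Set ℤ) : ObjectProperty C :=
  fun X => ∃ a, ∃ m ∈ I, Nonempty (X ≅ (S a)⟦m⟧)

/-- The extension closure of a collection. -/
abbrev heart {ι : Type w} (S : ι → C) : ObjectProperty C := extensionClosure (ofObj S)

variable {ι : Type w} {S : ι → C}

instance (I : Set ℤ) : (shiftsIn S I).IsClosedUnderIsomorphisms where
  of_iso := by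
    rintro X Y e ⟨a, m, hm, ⟨e'⟩⟩
    exact ⟨a, m, hm, ⟨e.symm ≪≫ e'⟩⟩

lemma shiftsIn_union (I J : Set ℤ) : shiftsIn S (I ∪ J) = shiftsIn S I ⊔ shiftsIn S J := by
  ext X
  constructor
  · rintro ⟨a, m, hm | hm, e⟩
    · exact Or.inl ⟨a, m, hm, e⟩
    · exact Or.inr ⟨a, m, hm, e⟩
  · rintro (⟨a, m, hm, e⟩ | ⟨a, m, hm, e⟩)
    · exact ⟨a, m, Or.inl hm, e⟩
    · exact ⟨a, m, Or.inr hm, e⟩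

lemma shiftsIn_mono {I J : Set ℤ} (h : I ⊆ J) : shiftsIn S I ≤ shiftsIn S J := by
  rintro X ⟨a, m, hm, e⟩
  exact ⟨a, m, h hm, e⟩

lemma shiftsIn_shift {I J : Set ℤ} (m : ℤ) (h : ∀ i ∈ I, i + m ∈ J) {X : C}
    (hX : extensionClosure (shiftsIn S I) X) : extensionClosure (shiftsIn S J) (X⟦m⟧) := by
  refine extensionClosure_shift m ?_ hX
  rintro X ⟨a, i, hi, ⟨e⟩⟩
  exact .of _ ⟨a, i + m, h i hi,
    ⟨(shiftFunctor C m).mapIso e ≪≫ ((shiftFunctorAdd C i m).app _).symm⟩⟩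

lemma heart_eq : heart S = extensionClosure (shiftsIn S {0}) := by
  apply le_antisymm
  · apply extensionClosure_mono
    rintro _ ⟨a⟩
    exact ⟨a, 0, rfl, ⟨((shiftFunctorZero C ℤ).app _).symm⟩⟩
  · refine extensionClosure_le ?_ (extensionProduct_extensionClosure_le _)
    rintro X ⟨a, _, rfl, ⟨e⟩⟩
    exact prop_of_iso _ (e ≪≫ (shiftFunctorZero C ℤ).app _).symm (.of _ ⟨a⟩)

lemma heart_shift (m : ℤ) {X : C} (hX : heart S X) :
    extensionClosure (shiftsIn S {m}) (X⟦m⟧) := by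
  rw [heart_eq] at hX
  exact shiftsIn_shift m (by simp) hX

lemma heart_of_shift {m l : ℤ} (h : m + l = 0) {X : C}
    (hX : extensionClosure (shiftsIn S {m}) X) : heart S (X⟦l⟧) := by
  rw [heart_eq]
  exact shiftsIn_shift l (by simpa using h) hX

namespace IsSimpleMinded

variable (hS : IsSimpleMinded S)
include hS

lemma hom_shiftsIn_eq_zero {I J : Set ℤ} (hIJ : ∀ i ∈ I, ∀ j ∈ J, j < i) (X Y : C)
    (hX : shiftsIn S I X) (hY : shiftsIn S J Y) (f : X ⟶ Y) : f = 0 := by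
  obtain ⟨a, i, hi, ⟨e⟩⟩ := hX
  obtain ⟨b, j, hj, ⟨e'⟩⟩ := hY
  have hf := hom_shift_eq_zero (n := j - i) (by lia)
    (hS.hom_neg a b (j - i) (by have := hIJ i hi j hj; lia)) (e.inv ≫ f ≫ e'.hom)
  rw [← cancel_mono e'.hom, ← cancel_epi e.inv, hf]
  simp

lemma hom_eq_zero {I J : Set ℤ} (hIJ : ∀ i ∈ I, ∀ j ∈ J, j < i) {X Y : C}
    (hX : extensionClosure (shiftsIn S I) X) (hY : extensionClosure (shiftsIn S J) Y)
    (f : X ⟶ Y) : f = 0 :=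
  hom_eq_zero_of_extensionClosure (hS.hom_shiftsIn_eq_zero hIJ) hX hY f

lemma hom_heart_eq_zero {X Y : C} (hX : heart S X) (hY : heart S Y) {n : ℤ} (hn : n < 0)
    (f : X ⟶ Y⟦n⟧) : f = 0 := by
  have hY := heart_shift n hY
  rw [heart_eq] at hX
  exact hS.hom_eq_zero (by simpa using hn) hX hY f

variable [IsTriangulated C]

/-- It suffices to treat a wrongly ordered extension with ends `S_b[j]` and `S_a[i]`, `j < i`. Its
connecting map goes to `S_b[j + 1]`, so it vanishes unless `j + 1 = i`, and in that case it is zero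
or invertible. If it is zero the extension splits and the summands can be exchanged; if it is
invertible the middle term is zero. -/
lemma extensionClosure_shiftsIn_union_le {I J : Set ℤ} (hIJ : ∀ i ∈ I, ∀ j ∈ J, j < i) :
    extensionClosure (shiftsIn S (I ∪ J)) ≤ extensionProduct (extensionClosure (shiftsIn S I))
      (extensionClosure (shiftsIn S J)) := by
  rw [shiftsIn_union]
  refine extensionClosure_sup_le ?_
  have hc : (shiftsIn S J ⊔ IsZero).ContainsZero := ⟨0, isZero_zero C, Or.inr (isZero_zero C)⟩
  rintro X ⟨Y, Z, f, g, h, hT, hY | hY, hZ⟩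
  · have hZ' := hZ
    have hY' := hY
    obtain ⟨a, i, hi, ⟨e⟩⟩ := hZ
    obtain ⟨b, j, hj, ⟨e'⟩⟩ := hY
    have hji := hIJ i hi j hj
    by_cases h0 : h = 0
    · subst h0
      obtain ⟨e, -⟩ := exists_iso_binaryBiproduct_of_distTriang _ hT rfl
      refine prop_of_iso _ (e ≪≫ biprod.braiding Y Z).symm ?_
      exact ⟨_, _, _, _, _, binaryBiproductTriangle_distinguished Z Y, .of _ hZ', Or.inl hY'⟩
    · have hij : j + 1 = i := by
        by_contra hne
        apply h0
        refine hS.hom_shiftsIn_eq_zero (I := {i}) (J := {j + 1}) ?_ _ _ ⟨a, i, rfl, ⟨e⟩⟩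
          ⟨b, j + 1, rfl, ⟨(shiftFunctor C 1).mapIso e' ≪≫
            ((shiftFunctorAdd C j 1).app _).symm⟩⟩ h
        simp; lia
      subst hij
      let e₁ := (shiftFunctor C 1).mapIso e' ≪≫ ((shiftFunctorAdd C j 1).app (S b)).symm
      obtain ⟨k, hk⟩ := (shiftFunctor C (j + 1)).map_surjective (e.inv ≫ h ≫ e₁.hom)
      have hk₀ : k ≠ 0 := by
        rintro rfl
        apply h0
        rw [Functor.map_zero] at hk
        rw [← cancel_mono e₁.hom, ← cancel_epi e.inv, ← hk]
        simp
      have := (hS.eq_zero_or_isIso _ _ k).resolve_left hk₀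
      have h1 : h = e.hom ≫ (k⟦(j + 1)⟧') ≫ e₁.inv := by rw [hk]; simp
      have : IsIso h := by rw [h1]; infer_instance
      have hX : IsZero X := (Triangle.isZero₂_iff_isIso₃ _ hT).2 this
      exact le_extensionProduct_left (shiftsIn S J ⊔ IsZero) _ (extensionClosure.zero X hX)
  · have : IsIso g := (Triangle.isZero₁_iff_isIso₂ _ hT).1 hY
    exact le_extensionProduct_left (shiftsIn S J ⊔ IsZero) _
      (prop_of_iso _ (asIso g).symm (extensionClosure.of Z hZ))

omit [IsTriangulated C] in
lemma exists_extensionClosure_shiftsIn (X : C) :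
    ∃ N : ℕ, extensionClosure (shiftsIn S (Set.Icc (-N : ℤ) N)) X := by
  have hX : generated S X := by rw [hS.full]; trivial
  have hmono : ∀ (N M : ℕ), N ≤ M → extensionClosure (shiftsIn S (Set.Icc (-N : ℤ) N)) ≤
      extensionClosure (shiftsIn S (Set.Icc (-M : ℤ) M)) := fun N M h =>
    extensionClosure_mono (shiftsIn_mono (Set.Icc_subset_Icc (by lia) (by lia)))
  induction hX with
  | of X hX =>
    obtain ⟨a⟩ := hX
    exact ⟨0, .of _ ⟨a, 0, by simp, ⟨((shiftFunctorZero C ℤ).app _).symm⟩⟩⟩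
  | zero X hX => exact ⟨0, .zero _ hX⟩
  | shift X a hX ih =>
    obtain ⟨N, hN⟩ := ih
    refine ⟨N + a.natAbs, shiftsIn_shift a ?_ hN⟩
    intro i hi
    simp only [Set.mem_Icc] at hi ⊢
    push_cast
    rcases abs_cases a <;> lia
  | ext T hT h₁ h₃ ih₁ ih₃ =>
    obtain ⟨N, hN⟩ := ih₁
    obtain ⟨M, hM⟩ := ih₃
    exact ⟨max N M, .ext T hT (hmono _ _ (le_max_left _ _) _ hN)
      (hmono _ _ (le_max_right _ _) _ hM)⟩

end IsSimpleMinded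

instance : (heart S).IsClosedUnderFiniteProducts :=
  isClosedUnderFiniteProducts_of_isTriangulatedClosed₂ _

namespace IsSimpleMinded

variable (hS : IsSimpleMinded S)
include hS

lemma heart_hom_eq_zero ⦃X Y : (heart S).FullSubcategory⦄ ⦃n : ℤ⦄
    (f : (heart S).ι.obj X ⟶ ((heart S).ι.obj Y)⟦n⟧) (hn : n < 0) : f = 0 :=
  hS.hom_heart_eq_zero X.property Y.property hn f

variable [IsTriangulated C]

/-- The cone of a morphism of the heart is built from members in shifts `0` and `1`. Sorting
presents it as an extension of some `Q` in the heart by a shift `K[1]` with `K` in the heart. These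
two are the cokernel and the kernel, as the criterion for an abelian subcategory demands. -/
lemma admissibleMorphism_eq_top :
    Triangulated.AbelianSubcategory.admissibleMorphism (heart S).ι = ⊤ := by
  rw [eq_top_iff]
  rintro X Y f - Z f₂ f₃ hT
  have hX : extensionClosure (shiftsIn S {1}) ((X.obj)⟦(1 : ℤ)⟧) := heart_shift 1 X.property
  have hY : extensionClosure (shiftsIn S {0}) Y.obj := by rw [← heart_eq]; exact Y.property
  have hZ : extensionClosure (shiftsIn S ({1} ∪ {0})) Z :=
    .ext _ (rot_of_distTriang _ hT) (extensionClosure_mono (shiftsIn_mono (by simp)) _ hY)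
      (extensionClosure_mono (shiftsIn_mono (by simp)) _ hX)
  obtain ⟨K, Q, α, β, γ, hT', hK, hQ⟩ := hS.extensionClosure_shiftsIn_union_le (by simp) _ hZ
  rw [← heart_eq] at hQ
  let e : (K⟦(-1 : ℤ)⟧)⟦(1 : ℤ)⟧ ≅ K := (shiftFunctorCompIsoId C (-1 : ℤ) 1 (by simp)).app K
  exact ⟨⟨_, heart_of_shift (m := 1) (l := -1) (by simp) hK⟩, ⟨Q, hQ⟩, e.hom ≫ α, β,
    γ ≫ e.inv⟦1⟧', distinguished_mk_of_iso hT' e (Iso.refl _) (Iso.refl _) (by simp) (by simp)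
      (by simp [← Functor.map_comp])⟩

/-- The extension closure of a simple-minded collection is abelian. -/
noncomputable abbrev abelianHeart : Abelian (heart S).FullSubcategory :=
  Triangulated.AbelianSubcategory.abelian (heart S).ι hS.heart_hom_eq_zero
    hS.admissibleMorphism_eq_top

lemma shortExact_of_distTriang {X₁ X₂ X₃ : (heart S).FullSubcategory} (f : X₁ ⟶ X₂) (g : X₂ ⟶ X₃)
    (h : X₃.obj ⟶ X₁.obj⟦(1 : ℤ)⟧) (hT : Triangle.mk f.hom g.hom h ∈ distTriang C) :
    ∃ w : f ≫ g = 0, (ShortComplex.mk f g w).ShortExact := by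
  let := hS.abelianHeart
  have hf := Triangulated.AbelianSubcategory.isLimitKernelForkOfDistTriang (ι := (heart S).ι)
    hS.heart_hom_eq_zero f g h hT
  have hg := Triangulated.AbelianSubcategory.isColimitCokernelCoforkOfDistTriang
    (ι := (heart S).ι) hS.heart_hom_eq_zero f g h hT
  have w : f ≫ g = 0 := (heart S).ι.map_injective (comp_distTriang_mor_zero₁₂ _ hT)
  have : Mono f := mono_of_isLimit_fork hf
  have : Epi g := epi_of_isColimit_cofork hg
  exact ⟨w, ⟨(ShortComplex.mk f g w).exact_of_f_is_kernel hf⟩⟩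

/-- An epimorphism of the heart has its fibre in the heart, and this fibre is a kernel. Uniqueness
of kernels transports the triangle to the given sequence. -/
lemma distTriang_of_shortExact {T : ShortComplex (heart S).FullSubcategory} (hT : T.ShortExact) :
    ∃ h : T.X₃.obj ⟶ T.X₁.obj⟦(1 : ℤ)⟧, Triangle.mk T.f.hom T.g.hom h ∈ distTriang C := by
  let := hS.abelianHeart
  have := hT.epi_g
  have := hT.mono_f
  obtain ⟨K, i, δ, hK⟩ := Triangulated.AbelianSubcategory.exists_distinguished_triangle_of_epi
    (ι := (heart S).ι) hS.heart_hom_eq_zero hS.admissibleMorphism_eq_top T.g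
  have hi := Triangulated.AbelianSubcategory.isLimitKernelForkOfDistTriang (ι := (heart S).ι)
    hS.heart_hom_eq_zero _ _ _ hK
  let e : K ≅ T.X₁ := IsLimit.conePointUniqueUpToIso hi hT.exact.fIsKernel
  have he : e.hom ≫ T.f = i :=
    IsLimit.conePointUniqueUpToIso_hom_comp hi hT.exact.fIsKernel WalkingParallelPair.zero
  let e' := (heart S).ι.mapIso e
  have he' : e'.hom ≫ T.f.hom = i.hom := congrArg (·.hom) he
  exact ⟨δ ≫ e'.hom⟦1⟧', distinguished_mk_of_iso hK e'.symm (Iso.refl _) (Iso.refl _)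
    (by simp [← he']) (by simp) (by simp [← Functor.map_comp])⟩

end IsSimpleMinded

end SimpleMinded

/-! ### Comparing arguments in the half plane. -/

section HalfPlane

/-- The determinant of a pair of complex numbers. -/
def cross (z w : ℂ) : ℝ := z.re * w.im - z.im * w.re

lemma mem_halfPlane_iff {z : ℂ} :
    z ∈ halfPlane ↔ z ≠ 0 ∧ 0 < Complex.arg z := by
  constructor
  · rintro ⟨r, t, hr, ht, ht', rfl⟩
    refine ⟨by simp [hr.ne'], ?_⟩
    have hm : Real.pi * t ∈ Set.Ioc (-Real.pi) Real.pi :=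
      ⟨by nlinarith [Real.pi_pos], by nlinarith [Real.pi_pos]⟩
    rw [Complex.exp_mul_I, Complex.arg_mul_cos_add_sin_mul_I hr hm]
    exact mul_pos Real.pi_pos ht
  · rintro ⟨hz, ha⟩
    refine ⟨‖z‖, Complex.arg z / Real.pi, by simpa using hz, div_pos ha Real.pi_pos,
      (div_le_one Real.pi_pos).2 (Complex.arg_le_pi z), ?_⟩
    rw [mul_div_cancel₀ _ Real.pi_ne_zero, Complex.norm_mul_exp_arg_mul_I]

lemma mem_halfPlane_iff' {z : ℂ} : z ∈ halfPlane ↔ 0 < z.im ∨ (z.im = 0 ∧ z.re < 0) := by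
  rw [mem_halfPlane_iff]
  constructor
  · rintro ⟨hz, ha⟩
    have h0 : 0 ≤ z.im := Complex.arg_nonneg_iff.1 ha.le
    rcases h0.lt_or_eq with h | h
    · exact Or.inl h
    · refine Or.inr ⟨h.symm, ?_⟩
      by_contra! hre
      exact ha.ne' (Complex.arg_eq_zero_iff.2 ⟨hre, h.symm⟩)
  · intro h
    refine ⟨by rintro rfl; simp at h, ?_⟩
    rcases h with h | h
    · refine lt_of_le_of_ne (Complex.arg_nonneg_iff.2 h.le) fun h' => ?_
      exact h.ne' (Complex.arg_eq_zero_iff.1 h'.symm).2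
    · rw [Complex.arg_eq_pi_iff.2 ⟨h.2, h.1⟩]
      exact Real.pi_pos

lemma cross_eq (z w : ℂ) :
    cross z w = ‖z‖ * ‖w‖ * Real.sin (Complex.arg w - Complex.arg z) := by
  rw [Real.sin_sub, cross]
  conv_lhs => rw [← Complex.norm_mul_cos_arg z, ← Complex.norm_mul_sin_arg z,
    ← Complex.norm_mul_cos_arg w, ← Complex.norm_mul_sin_arg w]
  ring

/-- Both arguments lie in `(0, π]`, so their difference lies in `(-π, π)`, where it has the sign of
its sine. Comparing phases thus becomes a condition that is linear in each variable. -/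
lemma arg_le_arg_iff {z w : ℂ} (hz : z ∈ halfPlane) (hw : w ∈ halfPlane) :
    Complex.arg z ≤ Complex.arg w ↔ 0 ≤ cross z w := by
  rw [mem_halfPlane_iff] at hz hw
  have h : 0 < ‖z‖ * ‖w‖ := mul_pos (by simpa using hz.1) (by simpa using hw.1)
  have := Complex.arg_le_pi z
  have := Complex.arg_le_pi w
  rw [cross_eq]
  constructor
  · intro hle
    exact mul_nonneg h.le (Real.sin_nonneg_of_nonneg_of_le_pi (by linarith) (by linarith))
  · intro hle
    by_contra! hlt
    have := mul_neg_of_pos_of_neg h (Real.sin_neg_of_neg_of_neg_pi_lt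
      (x := Complex.arg w - Complex.arg z) (by linarith) (by linarith))
    linarith

lemma add_mem_halfPlane {z w : ℂ} (hz : z ∈ halfPlane) (hw : w ∈ halfPlane) :
    z + w ∈ halfPlane := by
  rw [mem_halfPlane_iff'] at *
  simp only [Complex.add_im, Complex.add_re]
  rcases hz with hz | hz <;> rcases hw with hw | hw
  · left; linarith
  · left; linarith
  · left; linarith
  · right; constructor <;> linarith

end HalfPlane

/-! ### Filtrations with decreasing phases, in inductive form. -/

section Filtration

/-- `HasFiltration zero R G b X` means that `X` has a finite filtration with steps `R`, starting
with an object satisfying `zero`, whose graded pieces satisfy `G` for strictly decreasing real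
numbers greater than `b`. -/
inductive HasFiltration {A : Type u} (zero : A → Prop) (R : A → A → A → Prop) (G : ℝ → A → Prop) :
    ℝ → A → Prop
  | zero (b : ℝ) (X : A) (hX : zero X) : HasFiltration zero R G b X
  | step (b t : ℝ) (Y X F : A) (hR : R Y X F) (hG : G t F) (hb : b < t)
      (hY : HasFiltration zero R G t Y) : HasFiltration zero R G b X

variable {A : Type u} {zero : A → Prop} {R : A → A → A → Prop} {G : ℝ → A → Prop}

lemma HasFiltration.mono_bound {b b' : ℝ} (h : b' ≤ b) {X : A}
    (hX : HasFiltration zero R G b X) : HasFiltration zero R G b' X := by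
  cases hX with
  | zero _ _ hX => exact .zero _ _ hX
  | step _ t Y _ F hR hG hb hY => exact .step _ t Y _ F hR hG (h.trans_lt hb) hY

/-- The bound `b` is carried along because it is what makes the phases strictly decreasing when a
last step is attached. -/
lemma HasFiltration.exists_fin {b : ℝ} {X : A} (hX : HasFiltration zero R G b X) :
    ∃ (n : ℕ) (B : Fin (n + 1) → A) (F : Fin n → A) (φ : Fin n → ℝ),
      zero (B 0) ∧ B (Fin.last n) = X ∧ (∀ a : Fin n, R (B a.castSucc) (B a.succ) (F a)) ∧
      (∀ a, G (φ a) (F a)) ∧ StrictAnti φ ∧ ∀ a, b < φ a := by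
  induction hX with
  | zero b X hX =>
    exact ⟨0, fun _ => X, Fin.elim0, Fin.elim0, hX, rfl, fun a => a.elim0, fun a => a.elim0,
      fun a => a.elim0, fun a => a.elim0⟩
  | step b t Y X F hR hG hb hY ih =>
    obtain ⟨n, B, F', φ, h0, h1, h2, h3, h4, h5⟩ := ih
    refine ⟨n + 1, Fin.snoc (α := fun _ => A) B X, Fin.snoc (α := fun _ => A) F' F,
      Fin.snoc (α := fun _ => ℝ) φ t, ?_, ?_, ?_, ?_, ?_, ?_⟩
    · rw [← Fin.castSucc_zero, Fin.snoc_castSucc]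
      exact h0
    · simp
    · intro a
      induction a using Fin.lastCases with
      | last =>
        rw [Fin.snoc_castSucc, Fin.succ_last, Fin.snoc_last, Fin.snoc_last, h1]
        exact hR
      | cast a =>
        rw [Fin.snoc_castSucc, ← Fin.castSucc_succ, Fin.snoc_castSucc, Fin.snoc_castSucc]
        exact h2 a
    · intro a
      induction a using Fin.lastCases with
      | last => simpa using hG
      | cast a => simpa using h3 a
    · intro a a' haa'
      induction a' using Fin.lastCases with
      | last =>
        induction a using Fin.lastCases with
        | last => exact absurd haa' (lt_irrefl _)
        | cast a => simpa using h5 a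
      | cast a' =>
        induction a using Fin.lastCases with
        | last => exact absurd (haa'.trans (Fin.castSucc_lt_last a')) (lt_irrefl _)
        | cast a => simpa using h4 (by simpa using haa')
    · intro a
      induction a using Fin.lastCases with
      | last => simpa using hb
      | cast a => simpa using hb.trans (h5 a)

end Filtration

/-! ### Phase bounds on subobjects and quotients. -/

section Phases

variable {A : Type u} [Category.{v} A] [Preadditive A]

/-- The phases of all nonzero subobjects of `X` belong to `s`. -/
def SubPhases (Z : AbK A →+ ℂ) (s : Set ℝ) (X : A) : Prop :=
  ∀ (X' : A) (f : X' ⟶ X), Mono f → ¬ IsZero X' → phase Z X' ∈ s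

/-- The phases of all nonzero quotients of `X` belong to `s`. -/
def QuotPhases (Z : AbK A →+ ℂ) (s : Set ℝ) (X : A) : Prop :=
  ∀ (X' : A) (f : X ⟶ X'), Epi f → ¬ IsZero X' → phase Z X' ∈ s

lemma phase_le_one (Z : AbK A →+ ℂ) (X : A) : phase Z X ≤ 1 :=
  (div_le_one Real.pi_pos).2 (Complex.arg_le_pi _)

end Phases

/-! ### Stability functions on an abelian category. -/

section Abelian

variable {A : Type u} [Category.{v} A] [Abelian A]

lemma AbK.cls_of_shortExact {S : ShortComplex A} (hS : S.ShortExact) :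
    AbK.cls S.X₂ = AbK.cls S.X₁ + AbK.cls S.X₃ := by
  have h : FreeAbelianGroup.of S.X₂ - FreeAbelianGroup.of S.X₁ - FreeAbelianGroup.of S.X₃ ∈
      abRelations A := AddSubgroup.subset_closure ⟨S, hS, rfl⟩
  rw [← QuotientAddGroup.eq_zero_iff, QuotientAddGroup.mk_sub, QuotientAddGroup.mk_sub] at h
  rw [sub_sub, sub_eq_zero] at h
  exact h

lemma shortExact_kernel {X Y : A} (f : X ⟶ Y) [Epi f] :
    (ShortComplex.mk (kernel.ι f) f (kernel.condition f)).ShortExact where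
  exact := ShortComplex.exact_of_f_is_kernel _ (kernelIsKernel f)

lemma shortExact_cokernel {X Y : A} (f : X ⟶ Y) [Mono f] :
    (ShortComplex.mk f (cokernel.π f) (cokernel.condition f)).ShortExact where
  exact := ShortComplex.exact_of_g_is_cokernel _ (cokernelIsCokernel f)

lemma AbK.cls_kernel_add {X Y : A} (f : X ⟶ Y) [Epi f] :
    AbK.cls X = AbK.cls (kernel f) + AbK.cls Y :=
  AbK.cls_of_shortExact (shortExact_kernel f)

lemma AbK.cls_add_cokernel {X Y : A} (f : X ⟶ Y) [Mono f] :
    AbK.cls Y = AbK.cls X + AbK.cls (cokernel f) :=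
  AbK.cls_of_shortExact (shortExact_cokernel f)

lemma AbK.cls_of_isZero {X : A} (hX : IsZero X) : AbK.cls X = 0 := by
  have h : (ShortComplex.mk (0 : X ⟶ X) (𝟙 X) (by simp)).ShortExact :=
    { exact := ShortComplex.exact_of_isZero_X₂ _ hX
      mono_f := ⟨fun _ _ _ => hX.eq_of_tgt _ _⟩
      epi_g := inferInstance }
  simpa using AbK.cls_of_shortExact h

lemma AbK.cls_of_iso {X Y : A} (e : X ≅ Y) : AbK.cls X = AbK.cls Y := by
  rw [AbK.cls_kernel_add e.hom, AbK.cls_of_isZero (isZero_kernel_of_mono e.hom), zero_add]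

variable {Z : AbK A →+ ℂ}

lemma phase_of_iso {X Y : A} (e : X ≅ Y) : phase Z X = phase Z Y := by
  rw [phase, phase, AbK.cls_of_iso e]

lemma phase_mono_iff {X Y : A} :
    phase Z X ≤ phase Z Y ↔ Complex.arg (Z (AbK.cls X)) ≤ Complex.arg (Z (AbK.cls Y)) :=
  div_le_div_iff_of_pos_right Real.pi_pos

lemma SubPhases.of_mono {s : Set ℝ} {X Y : A} (h : SubPhases Z s Y) (f : X ⟶ Y) [Mono f] :
    SubPhases Z s X :=
  fun X' g _ h0 => h X' (g ≫ f) (mono_comp g f) h0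

lemma QuotPhases.of_epi {s : Set ℝ} {X Y : A} (h : QuotPhases Z s X) (f : X ⟶ Y) [Epi f] :
    QuotPhases Z s Y :=
  fun X' g _ h0 => h X' (f ≫ g) (epi_comp f g) h0

lemma SubPhases.mono {s s' : Set ℝ} (hs : s ⊆ s') {X : A} (h : SubPhases Z s X) :
    SubPhases Z s' X := fun X' f hf h0 => hs (h X' f hf h0)

lemma QuotPhases.mono {s s' : Set ℝ} (hs : s ⊆ s') {X : A} (h : QuotPhases Z s X) :
    QuotPhases Z s' X := fun X' f hf h0 => hs (h X' f hf h0)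

lemma SubPhases.self {s : Set ℝ} {X : A} (h : SubPhases Z s X) (h0 : ¬ IsZero X) :
    phase Z X ∈ s := h X (𝟙 X) inferInstance h0

lemma QuotPhases.self {s : Set ℝ} {X : A} (h : QuotPhases Z s X) (h0 : ¬ IsZero X) :
    phase Z X ∈ s := h X (𝟙 X) inferInstance h0

namespace IsStabilityFunction

variable (hZ : IsStabilityFunction Z)
include hZ

lemma phase_pos {X : A} (hX : ¬ IsZero X) : 0 < phase Z X :=
  div_pos (mem_halfPlane_iff.1 (hZ X hX)).2 Real.pi_pos

lemma phase_le_iff {X Y : A} (hX : ¬ IsZero X) (hY : ¬ IsZero Y) :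
    phase Z X ≤ phase Z Y ↔ 0 ≤ cross (Z (AbK.cls X)) (Z (AbK.cls Y)) :=
  phase_mono_iff.trans (arg_le_arg_iff (hZ X hX) (hZ Y hY))

lemma polar {X : A} (hX : ¬ IsZero X) : ∃ r : ℝ, 0 < r ∧ Z (AbK.cls X) =
    (r : ℂ) * Complex.exp (((Real.pi * phase Z X : ℝ) : ℂ) * Complex.I) := by
  refine ⟨‖Z (AbK.cls X)‖, by simpa using (mem_halfPlane_iff.1 (hZ X hX)).1, ?_⟩
  rw [phase, mul_div_cancel₀ _ Real.pi_ne_zero, Complex.norm_mul_exp_arg_mul_I]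

section

variable {X₁ X₂ X₃ : A} (h₁ : ¬ IsZero X₁) (h₂ : ¬ IsZero X₂) (h₃ : ¬ IsZero X₃)
  (h : AbK.cls X₂ = AbK.cls X₁ + AbK.cls X₃)
include h₁ h₂ h₃ h

/-- Since `cross z z = 0`, both inequalities say that `cross` is nonnegative on the charges of `X₁`
and `X₃`. -/
lemma phase_seesaw : phase Z X₁ ≤ phase Z X₂ ↔ phase Z X₂ ≤ phase Z X₃ := by
  rw [hZ.phase_le_iff h₁ h₂, hZ.phase_le_iff h₂ h₃, h, map_add]
  simp only [cross, Complex.add_re, Complex.add_im]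
  constructor <;> intro h <;> linarith

lemma phase_seesaw' : phase Z X₂ ≤ phase Z X₁ ↔ phase Z X₃ ≤ phase Z X₂ := by
  rw [hZ.phase_le_iff h₂ h₁, hZ.phase_le_iff h₃ h₂, h, map_add]
  simp only [cross, Complex.add_re, Complex.add_im]
  constructor <;> intro h <;> linarith

lemma phase_mem_of_ordConnected {s : Set ℝ} [s.OrdConnected] (hs₁ : phase Z X₁ ∈ s)
    (hs₃ : phase Z X₃ ∈ s) : phase Z X₂ ∈ s := by
  rcases le_total (phase Z X₁) (phase Z X₂) with h' | h'
  · exact Set.OrdConnected.out ‹_› hs₁ hs₃ ⟨h', (hZ.phase_seesaw h₁ h₂ h₃ h).1 h'⟩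
  · exact Set.OrdConnected.out ‹_› hs₃ hs₁ ⟨(hZ.phase_seesaw' h₁ h₂ h₃ h).1 h', h'⟩

end

/-- A subobject of the middle term is an extension of its image in `S.X₃` by a subobject of `S.X₁`.
By the seesaw property its phase lies between theirs, unless one of the two vanishes, when it is
isomorphic to the other. -/
lemma subPhases_of_shortExact {s : Set ℝ} [s.OrdConnected] {S : ShortComplex A}
    (hS : S.ShortExact) (h₁ : SubPhases Z s S.X₁) (h₃ : SubPhases Z s S.X₃) :
    SubPhases Z s S.X₂ := by
  intro X f hf hX
  have := hS.mono_f
  let g := factorThruImage (f ≫ S.g)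
  have hg : g ≫ image.ι (f ≫ S.g) = f ≫ S.g := image.fac _
  have hk : kernel.ι g ≫ f ≫ S.g = 0 := by
    have := kernel.condition g =≫ image.ι (f ≫ S.g)
    rwa [Category.assoc, hg, zero_comp] at this
  let l := hS.exact.lift (kernel.ι g ≫ f) (by rw [Category.assoc, hk])
  have hl : l ≫ S.f = kernel.ι g ≫ f := hS.exact.lift_f _ _
  have : Mono (l ≫ S.f) := by rw [hl]; exact mono_comp _ _
  have : Mono l := mono_of_mono l S.f
  by_cases hK : IsZero (kernel g)
  · have : Mono g := Preadditive.mono_of_kernel_zero (hK.eq_of_src _ _)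
    have := isIso_of_mono_of_epi g
    rw [phase_of_iso (asIso g)]
    exact h₃ _ (image.ι (f ≫ S.g)) inferInstance fun h0 => hX (h0.of_iso (asIso g))
  · by_cases hI : IsZero (image (f ≫ S.g))
    · have h0 : f ≫ S.g = 0 := by rw [← hg, hI.eq_of_tgt g 0, zero_comp]
      have : Mono (hS.exact.lift f h0 ≫ S.f) := by rw [hS.exact.lift_f]; exact hf
      exact h₁ _ (hS.exact.lift f h0) (mono_of_mono _ S.f) hX
    · exact hZ.phase_mem_of_ordConnected hK hX hI (AbK.cls_kernel_add g)
        (h₁ _ l inferInstance hK) (h₃ _ (image.ι _) inferInstance hI)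

lemma quotPhases_of_shortExact {s : Set ℝ} [s.OrdConnected] {S : ShortComplex A}
    (hS : S.ShortExact) (h₁ : QuotPhases Z s S.X₁) (h₃ : QuotPhases Z s S.X₃) :
    QuotPhases Z s S.X₂ := by
  intro X f hf hX
  have := hS.epi_g
  let g := image.ι (S.f ≫ f)
  have hg : factorThruImage (S.f ≫ f) ≫ g = S.f ≫ f := image.fac _
  have hk : S.f ≫ f ≫ cokernel.π g = 0 := by
    have := factorThruImage (S.f ≫ f) ≫= cokernel.condition g
    rwa [← Category.assoc, hg, Category.assoc, comp_zero] at this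
  let l := hS.exact.desc (f ≫ cokernel.π g) hk
  have hl : S.g ≫ l = f ≫ cokernel.π g := hS.exact.g_desc _ _
  have : Epi (S.g ≫ l) := by rw [hl]; exact epi_comp _ _
  have : Epi l := epi_of_epi S.g l
  by_cases hK : IsZero (cokernel g)
  · have : Epi g := Preadditive.epi_of_cokernel_zero (hK.eq_of_tgt _ _)
    have := isIso_of_mono_of_epi g
    rw [← phase_of_iso (asIso g)]
    exact h₁ _ (factorThruImage (S.f ≫ f)) inferInstance fun h0 => hX (h0.of_iso (asIso g).symm)
  · by_cases hI : IsZero (image (S.f ≫ f))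
    · have h0 : S.f ≫ f = 0 := by rw [← hg, hI.eq_of_src g 0, comp_zero]
      have : Epi (S.g ≫ hS.exact.desc f h0) := by rw [hS.exact.g_desc]; exact hf
      exact h₃ _ (hS.exact.desc f h0) (epi_of_epi S.g _) hX
    · exact hZ.phase_mem_of_ordConnected hI hX hK (AbK.cls_add_cokernel g)
        (h₁ _ (factorThruImage _) inferInstance hI) (h₃ _ l inferInstance hK)

lemma quotPhases_of_isSemistable {X : A} (hX : IsSemistable Z X) :
    QuotPhases Z (Set.Ici (phase Z X)) X := by
  intro Y f hf hY
  by_cases hK : IsZero (kernel f)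
  · have : Mono f := Preadditive.mono_of_kernel_zero (hK.eq_of_src _ _)
    have := isIso_of_mono_of_epi f
    exact (phase_of_iso (asIso f)).le
  · exact (hZ.phase_seesaw hK hX.1 hY (AbK.cls_kernel_add f)).1
      (hX.2 _ (kernel.ι f) inferInstance hK)

lemma subPhases_of_quotPhases {X : A} (hX : ¬ IsZero X)
    (h : QuotPhases Z (Set.Ici (phase Z X)) X) : SubPhases Z (Set.Iic (phase Z X)) X := by
  intro Y f hf hY
  by_cases hK : IsZero (cokernel f)
  · have : Epi f := Preadditive.epi_of_cokernel_zero (hK.eq_of_tgt _ _)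
    have := isIso_of_mono_of_epi f
    exact (phase_of_iso (asIso f)).le
  · exact (hZ.phase_seesaw hY hX hK (AbK.cls_add_cokernel f)).2
      (h _ (cokernel.π f) inferInstance hK)

/-- The right-hand side treats zero objects uniformly and consists of two bounds that are each
stable under extensions. -/
lemma isZero_or_isSemistable_iff {X : A} {t : ℝ} :
    (IsZero X ∨ (IsSemistable Z X ∧ phase Z X = t)) ↔
      (SubPhases Z (Set.Iic t) X ∧ QuotPhases Z (Set.Ici t) X) := by
  constructor
  · rintro (hX | ⟨hX, rfl⟩)
    · exact ⟨fun X' f hf h0 => (h0 (hX.of_mono f)).elim, fun X' f hf h0 => (h0 (hX.of_epi f)).elim⟩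
    · exact ⟨fun X' f hf h0 => hX.2 X' f hf h0, hZ.quotPhases_of_isSemistable hX⟩
  · rintro ⟨h₁, h₂⟩
    by_cases hX : IsZero X
    · exact Or.inl hX
    · have ht : phase Z X = t := le_antisymm (h₁.self hX) (h₂.self hX)
      exact Or.inr ⟨⟨hX, fun X' f hf h0 => ht ▸ h₁ X' f hf h0⟩, ht⟩

omit hZ in
-- The image is both a quotient of `X` and a subobject of `Y`.
lemma hom_eq_zero_of_disjoint {s s' : Set ℝ} (hs : Disjoint s s') {X Y : A}
    (hX : QuotPhases Z s X) (hY : SubPhases Z s' Y) (f : X ⟶ Y) : f = 0 := by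
  by_cases hI : IsZero (image f)
  · rw [← image.fac f, hI.eq_of_src (image.ι f) 0, comp_zero]
  · exact (Set.disjoint_left.1 hs (hX _ (factorThruImage f) inferInstance hI)
      (hY _ (image.ι f) inferInstance hI)).elim

section HarderNarasimhan

variable {len : AbK A →+ ℤ} (hlen : ∀ X : A, ¬ IsZero X → 0 < len (AbK.cls X))
  (hfin : ∀ N : ℤ, {z | ∃ X : A, len (AbK.cls X) ≤ N ∧ Z (AbK.cls X) = z}.Finite)

omit hZ in
include hlen in
lemma len_nonneg (X : A) : 0 ≤ len (AbK.cls X) := by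
  by_cases hX : IsZero X
  · rw [AbK.cls_of_isZero hX, map_zero]
  · exact (hlen X hX).le

omit hZ in
include hlen hfin in
/-- The maximal quotient of minimal phase. -/
lemma exists_minimal_quotient {X : A} (hX : ¬ IsZero X) :
    ∃ (Q : A) (f : X ⟶ Q), Epi f ∧ ¬ IsZero Q ∧ QuotPhases Z (Set.Ici (phase Z Q)) X ∧
      ∀ (Q' : A) (f' : X ⟶ Q'), Epi f' → ¬ IsZero Q' → phase Z Q' ≤ phase Z Q →
        len (AbK.cls Q') ≤ len (AbK.cls Q) := by
  have hle : ∀ {Q : A} (f : X ⟶ Q), Epi f → len (AbK.cls Q) ≤ len (AbK.cls X) := by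
    intro Q f hf
    rw [AbK.cls_kernel_add f, map_add]
    linarith [len_nonneg hlen (kernel f)]
  let s : Set ℝ := {t | ∃ (Q : A) (f : X ⟶ Q), Epi f ∧ ¬ IsZero Q ∧ phase Z Q = t}
  -- A quotient is no longer than `X`, so only finitely many charges, hence phases, occur.
  have hs : s.Finite := by
    refine ((hfin (len (AbK.cls X))).image fun z => Complex.arg z / Real.pi).subset ?_
    rintro t ⟨Q, f, hf, h0, rfl⟩
    exact ⟨_, ⟨Q, hle f hf, rfl⟩, rfl⟩
  obtain ⟨t, ⟨Q₀, f₀, hf₀, h₀, rfl⟩, ht⟩ := hs.exists_minimal ⟨_, X, 𝟙 X, inferInstance, hX, rfl⟩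
  have ht' : QuotPhases Z (Set.Ici (phase Z Q₀)) X := by
    intro Q f hf h0
    rcases le_total (phase Z Q₀) (phase Z Q) with h | h
    · exact h
    · exact ht ⟨Q, f, hf, h0, rfl⟩ h
  obtain ⟨l, ⟨Q, f, hf, h0, hQ, rfl⟩, hl⟩ := Int.exists_greatest_of_bdd
    (P := fun l => ∃ (Q : A) (f : X ⟶ Q), Epi f ∧ ¬ IsZero Q ∧ phase Z Q = phase Z Q₀ ∧
      len (AbK.cls Q) = l)
    ⟨len (AbK.cls X), by rintro l ⟨Q, f, hf, -, -, rfl⟩; exact hle f hf⟩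
    ⟨_, Q₀, f₀, hf₀, h₀, rfl, rfl⟩
  refine ⟨Q, f, hf, h0, by rwa [hQ], fun Q' f' hf' h0' h' => hl _ ⟨Q', f', hf', h0', ?_, rfl⟩⟩
  exact le_antisymm (hQ ▸ h') (ht' Q' f' hf' h0')

include hlen hfin in
-- Among the quotients of minimal phase, split off one of maximal length, then induct on the length
-- of the kernel. The lower set `U` keeps an upper bound on all phases of the filtration, which is
-- needed for interval subcategories.
lemma exists_hasFiltration {U : Set ℝ} (hU : IsLowerSet U) (X : A) (a : ℝ)
    (h₁ : SubPhases Z U X) (h₂ : QuotPhases Z (Set.Ioi a) X) :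
    HasFiltration IsZero (fun Y X F => ∃ (f : Y ⟶ X) (g : X ⟶ F) (h : f ≫ g = 0),
      (ShortComplex.mk f g h).ShortExact)
      (fun t F => IsSemistable Z F ∧ phase Z F = t ∧ t ∈ U) a X := by
  obtain ⟨N, hN⟩ : ∃ N : ℕ, len (AbK.cls X) = N :=
    ⟨_, (Int.toNat_of_nonneg (len_nonneg hlen X)).symm⟩
  induction N using Nat.strong_induction_on generalizing X a with
  | _ N ih =>
  by_cases hX : IsZero X
  · exact .zero _ _ hX
  obtain ⟨Q, f, hf, h0, hQ, hmax⟩ := exists_minimal_quotient hlen hfin hX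
  have hK : len (AbK.cls X) = len (AbK.cls (kernel f)) + len (AbK.cls Q) := by
    rw [AbK.cls_kernel_add f, map_add]
  have hQ0 := hlen Q h0
  have hK0 := len_nonneg hlen (kernel f)
  refine .step a (phase Z Q) (kernel f) X Q ⟨_, _, _, shortExact_kernel f⟩ ⟨⟨h0, ?_⟩, rfl, ?_⟩ ?_ ?_
  · exact fun X' g hg hX' => hZ.subPhases_of_quotPhases h0 (hQ.of_epi f) X' g hg hX'
  · exact hU (hQ.self hX) (h₁.self hX)
  · exact h₂ Q f hf h0
  · refine ih (len (AbK.cls (kernel f))).toNat (by lia) _ _ (h₁.of_mono (kernel.ι f)) ?_ (by lia)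
    intro R g hg hR
    by_contra! hRQ
    simp only [Set.mem_Ioi, not_lt] at hRQ
    -- If a quotient `R` of the kernel had phase at most that of `Q`, the quotient `cokernel j` of
    -- `X`, of class `[R] + [Q]`, would also have phase at most that of `Q` but be longer, against
    -- the choice of `Q`.
    let j := kernel.ι g ≫ kernel.ι f
    have : Mono j := mono_comp _ _
    have hP : AbK.cls (cokernel j) = AbK.cls R + AbK.cls Q := by
      have e₁ := AbK.cls_add_cokernel j
      have e₂ := AbK.cls_kernel_add f
      have e₃ := AbK.cls_kernel_add g
      rw [e₂, e₃, add_assoc] at e₁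
      exact (add_left_cancel e₁).symm
    have hR0 := hlen R hR
    have hP' : len (AbK.cls (cokernel j)) = len (AbK.cls R) + len (AbK.cls Q) := by
      rw [hP, map_add]
    have hP0 : ¬ IsZero (cokernel j) := by
      intro h
      rw [AbK.cls_of_isZero h, map_zero] at hP'
      lia
    have := hmax _ (cokernel.π j) inferInstance hP0
      (hZ.phase_mem_of_ordConnected (s := Set.Iic (phase Z Q)) hR hP0 h0 hP hRQ
        (le_refl (phase Z Q)))
    lia

include hlen hfin in
lemma hasHNProperty : HasHNProperty Z := by
  intro X hX
  obtain ⟨n, B, F, φ, h0, h1, h2, h3, h4, -⟩ := (hZ.exists_hasFiltration hlen hfin isLowerSet_univ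
    X 0 (fun _ _ _ _ => trivial) (fun _ _ _ h => hZ.phase_pos h)).exists_fin
  refine ⟨n, B, F, h0, ⟨eqToIso h1⟩, h2, fun a => (h3 a).1, ?_⟩
  have : (fun a => phase Z (F a)) = φ := funext fun a => (h3 a).2.1
  rwa [this]

end HarderNarasimhan

end IsStabilityFunction

/-! ### Chain conditions in full subcategories closed under images. -/

section FiniteLength

variable {D : Type w} [Category D] [Preadditive D] (Φ : D ⥤ A) [Φ.Full] [Φ.Faithful] [Φ.Additive]

/-- A kernel in `D` need not remain one under `Φ`. But the image of `Φ f` comes from some `I` in `D`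
that is killed by the morphism of which `f` is the kernel. Hence `I` maps back to `X`, and this
splits `X ⟶ I`. -/
lemma mono_map_of_isStrictMono
    (him : ∀ {X Y : D} (f : X ⟶ Y), ∃ I : D, Nonempty (Φ.obj I ≅ image (Φ.map f)))
    {X Y : D} (f : X ⟶ Y) (hf : IsStrictMono f) : Mono (Φ.map f) := by
  obtain ⟨hf⟩ := hf
  obtain ⟨I, ⟨e⟩⟩ := him f
  have : Mono f := mono_of_isLimit_fork hf.isLimit
  let i : I ⟶ Y := Φ.preimage (e.hom ≫ image.ι (Φ.map f))
  let p : X ⟶ I := Φ.preimage (factorThruImage (Φ.map f) ≫ e.inv)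
  have hpi : p ≫ i = f := Φ.map_injective (by simp [p, i])
  have hig : i ≫ hf.g = 0 := by
    apply Φ.map_injective
    have : image.ι (Φ.map f) ≫ Φ.map hf.g = 0 := by
      rw [← cancel_epi (factorThruImage (Φ.map f)), ← Category.assoc, image.fac, ← Φ.map_comp,
        hf.w, Φ.map_zero, comp_zero]
    simp [i, this]
  obtain ⟨l, hl⟩ : ∃ l : I ⟶ X, l ≫ f = i :=
    ⟨hf.isLimit.lift (KernelFork.ofι i hig), hf.isLimit.fac _ WalkingParallelPair.zero⟩
  have hpl : p ≫ l = 𝟙 X := by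
    rw [← cancel_mono f, Category.assoc, hl, hpi, Category.id_comp]
  have : IsSplitMono (Φ.map p) := ⟨⟨⟨Φ.map l, by rw [← Φ.map_comp, hpl, Φ.map_id]⟩⟩⟩
  have hΦp : Φ.map p = factorThruImage (Φ.map f) ≫ e.inv := by simp [p]
  have : Mono (factorThruImage (Φ.map f)) := by
    have : Mono (factorThruImage (Φ.map f) ≫ e.inv) := by rw [← hΦp]; infer_instance
    exact mono_of_mono _ e.inv
  rw [← image.fac (Φ.map f)]
  exact mono_comp _ _

/-- Strict subobjects map to subobjects of `Φ X`, whose length grows strictly along proper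
inclusions and is bounded by that of `Φ X`. -/
lemma isFiniteLengthCategory_of_fullyFaithful {len : AbK A →+ ℤ}
    (hlen : ∀ X : A, ¬ IsZero X → 0 < len (AbK.cls X))
    (him : ∀ {X Y : D} (f : X ⟶ Y), ∃ I : D, Nonempty (Φ.obj I ≅ image (Φ.map f))) :
    IsFiniteLengthCategory D := by
  intro X
  have hnn := IsStabilityFunction.len_nonneg hlen
  let r : {S : Subobject X // IsStrictMono S.arrow} → ℕ := fun S =>
    (len (AbK.cls (Φ.obj (S.1 : D)))).toNat
  have hr : StrictMono r := by
    intro S T hST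
    have hS := mono_map_of_isStrictMono Φ him _ S.2
    let j := Subobject.ofLE S.1 T.1 hST.le
    have hj : Φ.map j ≫ Φ.map T.1.arrow = Φ.map S.1.arrow := by
      rw [← Φ.map_comp, Subobject.ofLE_arrow]
    have : Mono (Φ.map j ≫ Φ.map T.1.arrow) := by rw [hj]; exact hS
    have : Mono (Φ.map j) := mono_of_mono _ (Φ.map T.1.arrow)
    have h0 : ¬ IsZero (cokernel (Φ.map j)) := by
      intro h0
      have : Epi (Φ.map j) := Preadditive.epi_of_cokernel_zero (h0.eq_of_tgt _ _)
      have := isIso_of_mono_of_epi (Φ.map j)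
      have : IsIso j := isIso_of_reflects_iso j Φ
      refine hST.not_ge ?_
      exact Subobject.le_of_comm (inv j) (by simp [j])
    have h1 := hlen _ h0
    have h2 := AbK.cls_add_cokernel (Φ.map j)
    have h3 := hnn (Φ.obj (S.1 : D))
    have h4 := congrArg len h2
    rw [map_add] at h4
    simp only [r]
    lia
  have hb : ∀ S, r S ≤ (len (AbK.cls (Φ.obj X))).toNat := by
    intro S
    have := mono_map_of_isStrictMono Φ him _ S.2
    have h2 := congrArg len (AbK.cls_add_cokernel (Φ.map S.1.arrow))
    rw [map_add] at h2
    have := hnn (cokernel (Φ.map S.1.arrow))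
    simp only [r]
    lia
  refine ⟨hr.wellFoundedLT, ?_⟩
  have hr' : StrictAnti fun S => (len (AbK.cls (Φ.obj X))).toNat - r S := by
    intro S T hST
    have := hr hST
    have := hb T
    dsimp only
    lia
  exact hr'.wellFoundedGT

end FiniteLength

end Abelian

/-! ### The Grothendieck group of a triangulated category. -/

section TriK

variable {C : Type u} [Category.{v} C] [Preadditive C] [HasZeroObject C] [HasShift C ℤ]
  [∀ m : ℤ, (shiftFunctor C m).Additive] [Pretriangulated C]

lemma TriK.cls_of_distTriang {T : Triangle C} (hT : T ∈ distTriang C) :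
    TriK.cls T.obj₂ = TriK.cls T.obj₁ + TriK.cls T.obj₃ := by
  have h : FreeAbelianGroup.of T.obj₂ - FreeAbelianGroup.of T.obj₁ - FreeAbelianGroup.of T.obj₃ ∈
      triRelations C := AddSubgroup.subset_closure ⟨T, hT, rfl⟩
  rw [← QuotientAddGroup.eq_zero_iff, QuotientAddGroup.mk_sub, QuotientAddGroup.mk_sub] at h
  rw [sub_sub, sub_eq_zero] at h
  exact h

lemma TriK.cls_of_isZero {X : C} (hX : IsZero X) : TriK.cls X = 0 := by
  have h : Triangle.mk (0 : X ⟶ X) (0 : X ⟶ X) 0 ∈ distTriang C :=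
    distinguished_mk_of_iso (contractible_distinguished X) (Iso.refl _) (Iso.refl _)
      (hX.iso (isZero_zero C)) (hX.eq_of_src _ _) (hX.eq_of_src _ _) (hX.eq_of_src _ _)
  simpa using TriK.cls_of_distTriang h

lemma TriK.cls_of_iso {X Y : C} (e : X ≅ Y) : TriK.cls X = TriK.cls Y := by
  have h : Triangle.mk e.hom (0 : Y ⟶ 0) 0 ∈ distTriang C :=
    distinguished_mk_of_iso (contractible_distinguished X) (Iso.refl _) e.symm (Iso.refl _)
      (by simp) (by simp) (by simp)
  have := TriK.cls_of_distTriang h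
  simp only [Triangle.mk_obj₁, Triangle.mk_obj₂, Triangle.mk_obj₃] at this
  rw [this, TriK.cls_of_isZero (isZero_zero C), add_zero]

lemma TriK.cls_shift_one (X : C) : TriK.cls (X⟦(1 : ℤ)⟧) = -TriK.cls X := by
  have h := TriK.cls_of_distTriang (rot_of_distTriang _ (contractible_distinguished X))
  have h' : TriK.cls (0 : C) = TriK.cls X + TriK.cls (X⟦(1 : ℤ)⟧) := h
  rw [TriK.cls_of_isZero (isZero_zero C)] at h'
  exact eq_neg_of_add_eq_zero_right h'.symm

/-- Two homomorphisms from the Grothendieck group agree if they agree on a generating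
collection. -/
lemma TriK.hom_ext {ι : Type w} {S : ι → C} (hS : generated S = ⊤) {M : Type*} [AddCommGroup M]
    {f g : TriK C →+ M} (h : ∀ a, f (TriK.cls (S a)) = g (TriK.cls (S a))) : f = g := by
  have hshift : ∀ (X : C), f (TriK.cls X) = g (TriK.cls X) → ∀ m : ℤ,
      f (TriK.cls (X⟦m⟧)) = g (TriK.cls (X⟦m⟧)) := by
    intro X hX m
    induction m using Int.induction_on with
    | zero => rwa [TriK.cls_of_iso ((shiftFunctorZero C ℤ).app X)]
    | succ m ih =>
      rw [TriK.cls_of_iso ((shiftFunctorAdd C (m : ℤ) 1).app X)]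
      change f (TriK.cls ((X⟦(m : ℤ)⟧)⟦(1 : ℤ)⟧)) = g (TriK.cls ((X⟦(m : ℤ)⟧)⟦(1 : ℤ)⟧))
      rw [TriK.cls_shift_one, map_neg, map_neg, ih]
    | pred m ih =>
      rw [TriK.cls_of_iso ((shiftFunctorAdd' C (-(m : ℤ) - 1) 1 (-(m : ℤ)) (by lia)).app X)] at ih
      change f (TriK.cls ((X⟦(-(m : ℤ) - 1)⟧)⟦(1 : ℤ)⟧)) =
        g (TriK.cls ((X⟦(-(m : ℤ) - 1)⟧)⟦(1 : ℤ)⟧)) at ih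
      rwa [TriK.cls_shift_one, map_neg, map_neg, neg_inj] at ih
  ext X
  change f (TriK.cls X) = g (TriK.cls X)
  have hX : generated S X := by rw [hS]; trivial
  induction hX with
  | of X hX => obtain ⟨a⟩ := hX; exact h a
  | zero X hX => rw [TriK.cls_of_isZero hX, map_zero, map_zero]
  | shift X a hX ih => exact hshift X ih a
  | ext T hT h₁ h₃ ih₁ ih₃ => rw [TriK.cls_of_distTriang hT, map_add, map_add, ih₁, ih₃]

lemma TriK.map_cls_shift (Z : TriK C →+ ℂ) (X : C) (m : ℤ) :
    Z (TriK.cls (X⟦m⟧)) =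
      Z (TriK.cls X) * Complex.exp (((Real.pi * m : ℝ) : ℂ) * Complex.I) := by
  have hstep : ∀ (Y : C) (t : ℝ), -(Z (TriK.cls Y)) *
      Complex.exp (((Real.pi * t : ℝ) : ℂ) * Complex.I) =
      Z (TriK.cls Y) * Complex.exp (((Real.pi * (t + 1) : ℝ) : ℂ) * Complex.I) := by
    intro Y t
    have : (((Real.pi * (t + 1) : ℝ) : ℂ) * Complex.I) =
      ((Real.pi * t : ℝ) : ℂ) * Complex.I + Real.pi * Complex.I := by push_cast; ring
    rw [this, Complex.exp_add, Complex.exp_pi_mul_I]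
    ring
  induction m using Int.induction_on with
  | zero => simp [TriK.cls_of_iso ((shiftFunctorZero C ℤ).app X)]
  | succ m ih =>
    rw [TriK.cls_of_iso ((shiftFunctorAdd C (m : ℤ) 1).app X)]
    change Z (TriK.cls ((X⟦(m : ℤ)⟧)⟦(1 : ℤ)⟧)) = _
    rw [TriK.cls_shift_one, map_neg, ih, ← neg_mul, hstep]
    push_cast
    rfl
  | pred m ih =>
    rw [TriK.cls_of_iso ((shiftFunctorAdd' C (-(m : ℤ) - 1) 1 (-(m : ℤ)) (by lia)).app X)] at ih
    change Z (TriK.cls ((X⟦(-(m : ℤ) - 1)⟧)⟦(1 : ℤ)⟧)) = _ at ih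
    rw [TriK.cls_shift_one, map_neg, neg_eq_iff_eq_neg, ← neg_mul] at ih
    have h : ((-(m : ℤ) : ℤ) : ℝ) = ((-(m : ℤ) - 1 : ℤ) : ℝ) + 1 := by push_cast; ring
    rw [ih, h, neg_mul, ← hstep, neg_mul, neg_neg]

end TriK

/-! ### Splicing filtrations in a triangulated category. -/

section TriangulatedFiltration

variable {C : Type u} [Category.{v} C] [Preadditive C] [HasZeroObject C] [HasShift C ℤ]
  [∀ m : ℤ, (shiftFunctor C m).Additive] [Pretriangulated C]

/-- `Y ⟶ X ⟶ F` is part of a distinguished triangle. -/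
def TriangleStep (Y X F : C) : Prop :=
  ∃ (f : Y ⟶ X) (g : X ⟶ F) (h : F ⟶ Y⟦(1 : ℤ)⟧), Triangle.mk f g h ∈ distTriang C

lemma TriangleStep.of_iso {Y X X' F : C} (h : TriangleStep Y X F) (e : X ≅ X') :
    TriangleStep Y X' F := by
  obtain ⟨f, g, k, hT⟩ := h
  exact ⟨f ≫ e.hom, e.inv ≫ g, k, distinguished_mk_of_iso hT (Iso.refl _) e.symm (Iso.refl _)
    (by simp) (by simp) (by simp)⟩

lemma HasFiltration.of_iso {G : ℝ → C → Prop} {b : ℝ} {X X' : C}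
    (h : HasFiltration IsZero TriangleStep G b X) (e : X ≅ X') :
    HasFiltration IsZero TriangleStep G b X' := by
  cases h with
  | zero _ _ hX => exact .zero _ _ (hX.of_iso e.symm)
  | step _ t Y _ F hR hG hb hY => exact .step _ t Y _ F (hR.of_iso e) hG hb hY

lemma HasFiltration.imp {A : Type u} {zero : A → Prop} {R : A → A → A → Prop}
    {G G' : ℝ → A → Prop} {b : ℝ} {X : A} (h : HasFiltration zero R G b X)
    (hG : ∀ t F, G t F → G' t F) : HasFiltration zero R G' b X := by
  induction h with
  | zero b X hX => exact .zero _ _ hX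
  | step b t Y X F hR hG' hb hY ih => exact .step b t Y X F hR (hG _ _ hG') hb ih

/-- Peel off the last factor `F` of `X₃`. By the octahedral axiom the fibre of `X ⟶ F` is an
extension of the remaining part of `X₃` by `X₁`, so induction applies. The phases of `X₁` exceed `c`
and those of `X₃` do not, so the order is right. -/
lemma HasFiltration.append [IsTriangulated C] {G : ℝ → C → Prop} {b c : ℝ} (hbc : b ≤ c)
    {X₁ X X₃ : C} (hX : TriangleStep X₁ X X₃)
    (h₁ : HasFiltration IsZero TriangleStep G c X₁)
    (h₃ : HasFiltration IsZero TriangleStep (fun t F => t ≤ c ∧ G t F) b X₃) :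
    HasFiltration IsZero TriangleStep G b X := by
  induction h₃ generalizing X with
  | zero b X₃ hX₃ =>
    obtain ⟨f, g, k, hT⟩ := hX
    have : IsIso f := (Triangle.isZero₃_iff_isIso₁ _ hT).1 hX₃
    exact (h₁.mono_bound hbc).of_iso (asIso f)
  | step b t Y X₃ F hR hG hb hY ih =>
    obtain ⟨f, g, k, hT⟩ := hX
    obtain ⟨f', g', k', hT'⟩ := hR
    obtain ⟨W, f'', h'', hT''⟩ := distinguished_cocone_triangle₁ (g ≫ g')
    let o := Triangulated.someOctahedron' rfl hT hT' hT''
    exact .step b t W X F ⟨_, _, _, hT''⟩ hG.2 hb (ih hG.1 ⟨_, _, _, o.mem⟩)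

end TriangulatedFiltration

/-! ### Central charges, ranks and lengths on the heart. -/

section HeartStability

variable {C : Type u} [Category.{v} C] [Preadditive C] [HasZeroObject C] [HasShift C ℤ]
  [∀ m : ℤ, (shiftFunctor C m).Additive] [Pretriangulated C]
  {ι : Type w} {S : ι → C}

/-- A nonzero object of the heart takes values in a set closed under addition if the members of the
collection do. -/
lemma isZero_or_mem_of_heart {M : Type*} [AddCommGroup M] (f : TriK C →+ M) {s : Set M}
    (hs : ∀ x ∈ s, ∀ y ∈ s, x + y ∈ s) (hS : ∀ a, f (TriK.cls (S a)) ∈ s) {X : C}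
    (hX : heart S X) : IsZero X ∨ f (TriK.cls X) ∈ s := by
  induction hX with
  | of X hX => obtain ⟨a⟩ := hX; exact Or.inr (hS a)
  | zero X hX => exact Or.inl hX
  | ext T hT h₁ h₃ ih₁ ih₃ =>
    have h := TriK.cls_of_distTriang hT
    rcases ih₁ with ih₁ | ih₁ <;> rcases ih₃ with ih₃ | ih₃
    · exact Or.inl (Triangle.isZero₂_of_isZero₁₃ _ hT ih₁ ih₃)
    · right; rwa [h, TriK.cls_of_isZero ih₁, zero_add]
    · right; rwa [h, TriK.cls_of_isZero ih₃, add_zero]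
    · right; rw [h, map_add]; exact hs _ ih₁ _ ih₃

/-- The subset of the half plane of elements of argument at least `c`. -/
lemma add_mem_halfPlane_arg {c : ℝ} {z w : ℂ} (hz : z ∈ halfPlane ∧ c ≤ Complex.arg z)
    (hw : w ∈ halfPlane ∧ c ≤ Complex.arg w) :
    z + w ∈ halfPlane ∧ c ≤ Complex.arg (z + w) := by
  have h := add_mem_halfPlane hz.1 hw.1
  refine ⟨h, ?_⟩
  rcases le_total (Complex.arg z) (Complex.arg w) with h' | h'
  · refine hz.2.trans ((arg_le_arg_iff hz.1 h).2 ?_)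
    have := (arg_le_arg_iff hz.1 hw.1).1 h'
    simp only [cross, Complex.add_re, Complex.add_im] at this ⊢
    linarith
  · refine hw.2.trans ((arg_le_arg_iff hw.1 h).2 ?_)
    have := (arg_le_arg_iff hw.1 hz.1).1 h'
    simp only [cross, Complex.add_re, Complex.add_im] at this ⊢
    linarith

/-- A rank function on the Grothendieck group. -/
def IsRankFunction [DecidableEq ι] (S : ι → C) (rk : TriK C →+ (ι → ℤ)) : Prop :=
  ∀ a, rk (TriK.cls (S a)) = Pi.single a 1

namespace IsRankFunction

variable [DecidableEq ι] {rk : TriK C →+ (ι → ℤ)} (hrk : IsRankFunction S rk)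
include hrk

lemma nonneg {X : C} (hX : heart S X) (a : ι) : 0 ≤ rk (TriK.cls X) a := by
  rcases isZero_or_mem_of_heart ((Pi.evalAddMonoidHom _ a).comp rk) (s := Set.Ici 0)
    (fun x hx y hy => add_nonneg (Set.mem_Ici.1 hx) (Set.mem_Ici.1 hy)) (fun b => by
      change 0 ≤ rk (TriK.cls (S b)) a
      rw [hrk b, Pi.single_apply]
      split_ifs <;> simp) hX with h | h
  · rw [TriK.cls_of_isZero h, map_zero]; rfl
  · exact h

variable [Fintype ι]

lemma sum_pos {X : C} (hX : heart S X) (h0 : ¬ IsZero X) : 0 < ∑ a, rk (TriK.cls X) a := by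
  let f : TriK C →+ ℤ :=
    { toFun := fun x => ∑ a, rk x a
      map_zero' := by simp
      map_add' := fun x y => by simp [Finset.sum_add_distrib] }
  exact (isZero_or_mem_of_heart f (s := Set.Ioi 0)
    (fun x hx y hy => add_pos (Set.mem_Ioi.1 hx) (Set.mem_Ioi.1 hy))
    (fun b => by
      change 0 < ∑ a, rk (TriK.cls (S b)) a
      rw [hrk b]; simp) hX).resolve_left h0

lemma map_eq_sum (hS : generated S = ⊤) (Z : TriK C →+ ℂ) (x : TriK C) :
    Z x = ∑ a, (rk x a : ℂ) * Z (TriK.cls (S a)) := by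
  let f : TriK C →+ ℂ :=
    { toFun := fun x => ∑ a, (rk x a : ℂ) * Z (TriK.cls (S a))
      map_zero' := by simp
      map_add' := fun x y => by simp [Finset.sum_add_distrib, add_mul] }
  refine DFunLike.congr_fun (TriK.hom_ext (g := f) hS fun b => ?_) x
  change _ = ∑ a, (rk (TriK.cls (S b)) a : ℂ) * Z (TriK.cls (S a))
  rw [hrk b, Finset.sum_eq_single b]
  · simp
  · intro a _ hab
    simp [hab]
  · simp

end IsRankFunction

variable [IsTriangulated C] (hS : IsSimpleMinded S)

/-- The homomorphism from the Grothendieck group of the heart to that of the triangulated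
category. -/
noncomputable def heartHom : AbK (heart S).FullSubcategory →+ TriK C :=
  QuotientAddGroup.lift (abRelations _)
    (FreeAbelianGroup.lift fun X => TriK.cls X.obj) (by
      rw [abRelations, AddSubgroup.closure_le]
      rintro _ ⟨T, hT, rfl⟩
      obtain ⟨h, hT'⟩ := hS.distTriang_of_shortExact hT
      have := TriK.cls_of_distTriang hT'
      simp only [Triangle.mk_obj₁, Triangle.mk_obj₂, Triangle.mk_obj₃] at this
      simp [this])

lemma heartHom_cls (X : (heart S).FullSubcategory) :
    heartHom hS (AbK.cls X) = TriK.cls X.obj := by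
  change FreeAbelianGroup.lift (fun X : (heart S).FullSubcategory => TriK.cls X.obj)
    (FreeAbelianGroup.of X) = _
  simp

/-- The restriction of a central charge to the heart. -/
noncomputable abbrev heartCharge (Z : TriK C →+ ℂ) : AbK (heart S).FullSubcategory →+ ℂ :=
  Z.comp (heartHom hS)

variable {Z : TriK C →+ ℂ} (hZ : ∀ a, Z (TriK.cls (S a)) ∈ halfPlane)

lemma heartCharge_cls (X : (heart S).FullSubcategory) :
    heartCharge hS Z (AbK.cls X) = Z (TriK.cls X.obj) := by
  rw [AddMonoidHom.comp_apply, heartHom_cls]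

include hZ in
lemma isStabilityFunction_heartCharge : IsStabilityFunction (heartCharge hS Z) := by
  intro X hX
  rw [heartCharge_cls]
  exact (isZero_or_mem_of_heart Z (fun _ h _ h' => add_mem_halfPlane h h') hZ
    X.property).resolve_left (by rwa [← isZero_fullSubcategory_iff])

include hZ in
-- The smallest phase of the finitely many members works, because the part of the half plane with
-- argument at least a given number is closed under addition.
lemma exists_phase_lower_bound [Finite ι] : ∃ φ : ℝ, 0 < φ ∧ φ ≤ 1 ∧
    ∀ X : (heart S).FullSubcategory, ¬ IsZero X → φ ≤ phase (heartCharge hS Z) X := by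
  obtain ⟨φ, h0, h1, hφ⟩ : ∃ φ : ℝ, 0 < φ ∧ φ ≤ 1 ∧
      ∀ a, φ ≤ Complex.arg (Z (TriK.cls (S a))) / Real.pi := by
    cases isEmpty_or_nonempty ι with
    | inl h => exact ⟨1, one_pos, le_rfl, fun a => h.elim a⟩
    | inr h =>
      obtain ⟨a, ha⟩ := Finite.exists_min fun a => Complex.arg (Z (TriK.cls (S a))) / Real.pi
      exact ⟨_, div_pos (mem_halfPlane_iff.1 (hZ a)).2 Real.pi_pos,
        (div_le_one Real.pi_pos).2 (Complex.arg_le_pi _), ha⟩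
  refine ⟨φ, h0, h1, fun X hX => ?_⟩
  rw [phase, heartCharge_cls, le_div_iff₀ Real.pi_pos]
  have := isZero_or_mem_of_heart Z (s := {z | z ∈ halfPlane ∧ φ * Real.pi ≤ Complex.arg z})
    (fun _ h _ h' => add_mem_halfPlane_arg h h')
    (fun a => ⟨hZ a, (le_div_iff₀ Real.pi_pos).1 (hφ a)⟩) X.property
  exact (this.resolve_left (by rwa [← isZero_fullSubcategory_iff])).2

variable [DecidableEq ι] [Fintype ι] {rk : TriK C →+ (ι → ℤ)} (hrk : IsRankFunction S rk)

/-- The length function of the heart. -/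
noncomputable def heartLength (rk : TriK C →+ (ι → ℤ)) : AbK (heart S).FullSubcategory →+ ℤ where
  toFun x := ∑ a, rk (heartHom hS x) a
  map_zero' := by simp
  map_add' x y := by simp [Finset.sum_add_distrib]

lemma heartLength_cls (X : (heart S).FullSubcategory) :
    heartLength hS rk (AbK.cls X) = ∑ a, rk (TriK.cls X.obj) a := by
  rw [← heartHom_cls hS]
  rfl

include hrk in
lemma heartLength_pos (X : (heart S).FullSubcategory) (hX : ¬ IsZero X) :
    0 < heartLength hS rk (AbK.cls X) := by
  rw [heartLength_cls]
  exact hrk.sum_pos X.property (by rwa [← isZero_fullSubcategory_iff])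

include hrk in
-- The charge depends only on the rank vector, and bounded length confines that vector to a finite
-- box.
lemma finite_heartCharge (N : ℤ) : {z | ∃ X : (heart S).FullSubcategory,
    heartLength hS rk (AbK.cls X) ≤ N ∧ heartCharge hS Z (AbK.cls X) = z}.Finite := by
  refine ((Set.finite_Icc (0 : ι → ℤ) (fun _ => N)).image
    fun f => ∑ a, (f a : ℂ) * Z (TriK.cls (S a))).subset ?_
  rintro _ ⟨X, hX, rfl⟩
  rw [heartLength_cls] at hX
  refine ⟨rk (TriK.cls X.obj), ⟨fun a => hrk.nonneg X.property a, fun a => ?_⟩, ?_⟩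
  · exact (Finset.single_le_sum (fun b _ => hrk.nonneg X.property b)
      (Finset.mem_univ a)).trans hX
  · rw [heartCharge_cls]
    exact (hrk.map_eq_sum hS.full Z _).symm

end HeartStability

/-! ### The slicing attached to a central charge. -/

section Slicing

variable {C : Type u} [Category.{v} C] [Preadditive C] [HasZeroObject C] [HasShift C ℤ]
  [∀ m : ℤ, (shiftFunctor C m).Additive] [Pretriangulated C]
  {ι : Type w} {S : ι → C} [IsTriangulated C] (hS : IsSimpleMinded S) (Z : TriK C →+ ℂ)

/-- The zero objects and the semistable objects of phase `t` of the heart. -/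
def heartSlice (t : ℝ) : ObjectProperty C := fun X =>
  ∃ hX : heart S X, IsZero X ∨ (IsSemistable (heartCharge hS Z) ⟨X, hX⟩ ∧
    phase (heartCharge hS Z) ⟨X, hX⟩ = t)

/-- The slicing defined by a central charge. -/
def slicing (t : ℝ) : ObjectProperty C := fun X =>
  heartSlice hS Z (t - (⌈t⌉ - 1 : ℤ)) (X⟦-(⌈t⌉ - 1)⟧)

lemma slicing_iff {t : ℝ} {m : ℤ} (h₀ : 0 < t - m) (h₁ : t - m ≤ 1) (X : C) :
    slicing hS Z t X ↔ heartSlice hS Z (t - m) (X⟦-m⟧) := by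
  have : ⌈t⌉ = m + 1 := by
    rw [Int.ceil_eq_iff]
    push_cast
    constructor <;> linarith
  obtain rfl : m = ⌈t⌉ - 1 := by lia
  rfl

lemma exists_slicing_index (t : ℝ) : ∃ m : ℤ, 0 < t - m ∧ t - m ≤ 1 := by
  refine ⟨⌈t⌉ - 1, ?_, ?_⟩
  · have := Int.ceil_lt_add_one t
    push_cast; linarith
  · have := Int.le_ceil t
    push_cast; linarith

variable {Z} (hZ : ∀ a, Z (TriK.cls (S a)) ∈ halfPlane)

include hZ in
lemma heartSlice_iff (t : ℝ) (X : C) : heartSlice hS Z t X ↔ ∃ hX : heart S X,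
    SubPhases (heartCharge hS Z) (Set.Iic t) ⟨X, hX⟩ ∧
      QuotPhases (heartCharge hS Z) (Set.Ici t) ⟨X, hX⟩ := by
  let := hS.abelianHeart
  have h : ∀ hX : heart S X, IsZero X ↔ IsZero (⟨X, hX⟩ : (heart S).FullSubcategory) :=
    fun hX => (isZero_fullSubcategory_iff (heart S) ⟨X, hX⟩).symm
  simp only [heartSlice]
  refine exists_congr fun hX => ?_
  rw [h hX]
  exact (isStabilityFunction_heartCharge hS hZ).isZero_or_isSemistable_iff

lemma subPhases_of_iso {A : Type u} [Category.{v} A] [Preadditive A] {Z : AbK A →+ ℂ} {s : Set ℝ}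
    {X Y : A} (e : X ≅ Y) (h : SubPhases Z s X) : SubPhases Z s Y :=
  fun X' f _ h0 => h X' (f ≫ e.inv) (mono_comp f e.inv) h0

lemma quotPhases_of_iso {A : Type u} [Category.{v} A] [Preadditive A] {Z : AbK A →+ ℂ} {s : Set ℝ}
    {X Y : A} (e : X ≅ Y) (h : QuotPhases Z s X) : QuotPhases Z s Y :=
  fun X' f _ h0 => h X' (e.hom ≫ f) (epi_comp e.hom f) h0

variable (Z) in
/-- Objects of the heart all of whose nonzero subobjects have phases in `s` and all of whose nonzero
quotients have phases in `s'`. -/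
def phaseBounded (s s' : Set ℝ) : ObjectProperty C := fun X => ∃ hX : heart S X,
  SubPhases (heartCharge hS Z) s ⟨X, hX⟩ ∧ QuotPhases (heartCharge hS Z) s' ⟨X, hX⟩

instance (s s' : Set ℝ) : (phaseBounded hS Z s s').IsClosedUnderIsomorphisms where
  of_iso {X Y} e := by
    rintro ⟨hX, h₁, h₂⟩
    let e' : (⟨X, hX⟩ : (heart S).FullSubcategory) ≅ ⟨Y, prop_of_iso _ e hX⟩ :=
      (heart S).fullyFaithfulι.preimageIso e
    exact ⟨prop_of_iso _ e hX, subPhases_of_iso e' h₁, quotPhases_of_iso e' h₂⟩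

lemma phaseBounded_of_isZero (s s' : Set ℝ) {X : C} (hX : IsZero X) :
    phaseBounded hS Z s s' X := by
  let := hS.abelianHeart
  have h : IsZero (⟨X, .zero _ hX⟩ : (heart S).FullSubcategory) :=
    (isZero_fullSubcategory_iff _ _).2 hX
  exact ⟨.zero _ hX, fun X' f _ h0 => (h0 (h.of_mono f)).elim,
    fun X' f _ h0 => (h0 (h.of_epi f)).elim⟩

instance (s s' : Set ℝ) : (phaseBounded hS Z s s').ContainsZero where
  exists_zero := ⟨0, isZero_zero C, phaseBounded_of_isZero hS s s' (isZero_zero C)⟩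

include hZ in
lemma phaseBounded_of_distTriang {s s' : Set ℝ} [s.OrdConnected] [s'.OrdConnected]
    {T : Triangle C} (hT : T ∈ distTriang C) (h₁ : phaseBounded hS Z s s' T.obj₁)
    (h₃ : phaseBounded hS Z s s' T.obj₃) : phaseBounded hS Z s s' T.obj₂ := by
  let := hS.abelianHeart
  obtain ⟨hX₁, h₁, h₁'⟩ := h₁
  obtain ⟨hX₃, h₃, h₃'⟩ := h₃
  have hX₂ : heart S T.obj₂ := .ext T hT hX₁ hX₃
  obtain ⟨w, hw⟩ := hS.shortExact_of_distTriang (X₁ := ⟨_, hX₁⟩) (X₂ := ⟨_, hX₂⟩) (X₃ := ⟨_, hX₃⟩)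
    (homMk T.mor₁) (homMk T.mor₂) T.mor₃ hT
  have hZ' := isStabilityFunction_heartCharge hS hZ
  exact ⟨hX₂, hZ'.subPhases_of_shortExact hw h₁ h₃, hZ'.quotPhases_of_shortExact hw h₁' h₃'⟩

include hZ in
lemma heartSlice_eq (t : ℝ) :
    heartSlice hS Z t = phaseBounded hS Z (Set.Iic t) (Set.Ici t) := by
  ext X
  exact heartSlice_iff hS hZ t X

/-- A property of objects that is closed under isomorphisms and extensions and contains zero is
closed under finite products; so are its shifts. -/
lemma isClosedUnderFiniteProducts_shift {P : ObjectProperty C} [P.IsClosedUnderIsomorphisms]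
    [P.ContainsZero]
    (hP : ∀ T ∈ distTriang C, P T.obj₁ → P T.obj₃ → P T.obj₂) (Q : ObjectProperty C) (m : ℤ)
    (hQ : ∀ X, Q X ↔ P (X⟦m⟧)) : Q.IsClosedUnderIsomorphisms ∧ Q.IsClosedUnderFiniteProducts := by
  have h₁ : Q.IsClosedUnderIsomorphisms := ⟨fun {X Y} e hX =>
    (hQ Y).2 (P.prop_of_iso ((shiftFunctor C m).mapIso e) ((hQ X).1 hX))⟩
  have h₂ : Q.ContainsZero := ⟨0, isZero_zero C,
    (hQ 0).2 (P.prop_of_isZero (Functor.map_isZero _ (isZero_zero C)))⟩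
  have h₃ : Q.IsTriangulatedClosed₂ := .mk' fun T hT hT₁ hT₃ => (hQ _).2
    (hP _ (Triangle.shift_distinguished T hT m) ((hQ _).1 hT₁) ((hQ _).1 hT₃))
  exact ⟨h₁, isClosedUnderFiniteProducts_of_isTriangulatedClosed₂ Q⟩

include hZ in
lemma slicing_closed (t : ℝ) : (slicing hS Z t).IsClosedUnderIsomorphisms ∧
    (slicing hS Z t).IsClosedUnderFiniteProducts := by
  refine isClosedUnderFiniteProducts_shift
    (P := phaseBounded hS Z (Set.Iic (t - (⌈t⌉ - 1 : ℤ))) (Set.Ici (t - (⌈t⌉ - 1 : ℤ))))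
    (fun T hT => phaseBounded_of_distTriang hS hZ hT) _ (-(⌈t⌉ - 1)) fun X => ?_
  rw [← heartSlice_eq hS hZ]
  rfl

include hZ in
lemma heartSlice_of_iso {t : ℝ} {X Y : C} (e : X ≅ Y) (h : heartSlice hS Z t X) :
    heartSlice hS Z t Y := by
  rw [heartSlice_eq hS hZ] at h ⊢
  exact prop_of_iso _ e h

include hZ in
lemma slicing_shift_iff (t : ℝ) (X : C) (n : ℤ) :
    slicing hS Z (t + n) (X⟦n⟧) ↔ slicing hS Z t X := by
  obtain ⟨m, h₀, h₁⟩ := exists_slicing_index t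
  have h : t + n - (m + n : ℤ) = t - m := by push_cast; ring
  rw [slicing_iff hS Z h₀ h₁, slicing_iff (m := m + n) hS Z (by rwa [h]) (by rwa [h]), h]
  let e : (X⟦n⟧)⟦-(m + n)⟧ ≅ X⟦-m⟧ := ((shiftFunctorAdd' C n (-(m + n)) (-m) (by lia)).app X).symm
  exact ⟨heartSlice_of_iso hS hZ e, heartSlice_of_iso hS hZ e.symm⟩

lemma mem_shiftsIn_of_heart_shift {X : C} {m : ℤ} (h : heart S (X⟦-m⟧)) :
    extensionClosure (shiftsIn S {m}) X :=
  prop_of_iso _ ((shiftFunctorCompIsoId C (-m) m (by simp)).app X) (heart_shift m h)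

include hZ in
-- If the two objects lie in different shifts of the heart, there are no negative extensions. If
-- they lie in the same shift, the phases of quotients of the source and subobjects of the target
-- are disjoint.
lemma slicing_hom_eq_zero {t₁ t₂ : ℝ} (h : t₂ < t₁) {X₁ X₂ : C} (h₁ : slicing hS Z t₁ X₁)
    (h₂ : slicing hS Z t₂ X₂) (f : X₁ ⟶ X₂) : f = 0 := by
  obtain ⟨m₁, h₁₀, h₁₁⟩ := exists_slicing_index t₁
  obtain ⟨m₂, h₂₀, h₂₁⟩ := exists_slicing_index t₂
  rw [slicing_iff hS Z h₁₀ h₁₁, heartSlice_iff hS hZ] at h₁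
  rw [slicing_iff hS Z h₂₀ h₂₁, heartSlice_iff hS hZ] at h₂
  obtain ⟨hX₁, -, h₁⟩ := h₁
  obtain ⟨hX₂, h₂, -⟩ := h₂
  have hm : m₂ ≤ m₁ := by
    by_contra! hlt
    have : (m₁ : ℝ) + 1 ≤ m₂ := by exact_mod_cast hlt
    linarith
  rcases hm.lt_or_eq with hm | rfl
  · exact hS.hom_eq_zero (I := {m₁}) (J := {m₂}) (by simpa using hm)
      (mem_shiftsIn_of_heart_shift hX₁) (mem_shiftsIn_of_heart_shift hX₂) f
  · let := hS.abelianHeart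
    let g : (⟨_, hX₁⟩ : (heart S).FullSubcategory) ⟶ ⟨_, hX₂⟩ := homMk (f⟦-m₂⟧')
    have hg : g = 0 := IsStabilityFunction.hom_eq_zero_of_disjoint
      (s := Set.Ici (t₁ - m₂)) (s' := Set.Iic (t₂ - m₂))
      (Set.disjoint_left.2 fun x hx hx' => by simp only [Set.mem_Ici, Set.mem_Iic] at hx hx'; linarith)
      h₁ h₂ g
    apply (shiftFunctor C (-m₂)).map_injective
    rw [Functor.map_zero]
    exact congrArg (·.hom) hg

include hZ in
lemma slicing_central_charge {t : ℝ} {X : C} (hX : slicing hS Z t X) (h0 : ¬ IsZero X) :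
    ∃ r : ℝ, 0 < r ∧
      Z (TriK.cls X) = (r : ℂ) * Complex.exp (((Real.pi * t : ℝ) : ℂ) * Complex.I) := by
  let := hS.abelianHeart
  obtain ⟨m, h₀, h₁⟩ := exists_slicing_index t
  rw [slicing_iff hS Z h₀ h₁] at hX
  let e : (X⟦-m⟧)⟦m⟧ ≅ X := (shiftFunctorCompIsoId C (-m) m (by simp)).app X
  have h0' : ¬ IsZero (X⟦-m⟧) := fun h =>
    h0 ((Functor.map_isZero (shiftFunctor C m) h).of_iso e.symm)
  obtain ⟨hX, h⟩ := hX
  obtain ⟨hs, ht⟩ := h.resolve_left h0'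
  obtain ⟨r, hr, h⟩ := (isStabilityFunction_heartCharge hS hZ).polar hs.1
  rw [heartCharge_cls, ht] at h
  refine ⟨r, hr, ?_⟩
  rw [← TriK.cls_of_iso e, TriK.map_cls_shift, h, mul_assoc, ← Complex.exp_add]
  congr 2
  push_cast
  ring

include hZ in
lemma slicing_of_isSemistable {F : (heart S).FullSubcategory} {t : ℝ}
    (hF : IsSemistable (heartCharge hS Z) F) (ht : phase (heartCharge hS Z) F = t) (m : ℤ) :
    slicing hS Z (t + m) (F.obj⟦m⟧) := by
  let := hS.abelianHeart
  rw [slicing_shift_iff hS hZ]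
  have h0 := (isStabilityFunction_heartCharge hS hZ).phase_pos hF.1
  have h1 := phase_le_one (heartCharge hS Z) F
  rw [ht] at h0 h1
  rw [slicing_iff (m := 0) hS Z (by simpa using h0) (by simpa using h1)]
  simp only [Int.cast_zero, sub_zero, neg_zero]
  exact heartSlice_of_iso hS hZ ((shiftFunctorZero C ℤ).app F.obj).symm
    ⟨F.property, Or.inr ⟨hF, ht⟩⟩

variable [DecidableEq ι] [Fintype ι] {rk : TriK C →+ (ι → ℤ)} (hrk : IsRankFunction S rk)

include hZ in
lemma hasFiltration_shift_of_heart {U : Set ℝ} (m : ℤ) {X : (heart S).FullSubcategory} {a : ℝ}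
    (h : HasFiltration IsZero (fun Y X F => ∃ (f : Y ⟶ X) (g : X ⟶ F) (h : f ≫ g = 0),
      (ShortComplex.mk f g h).ShortExact)
      (fun t F => IsSemistable (heartCharge hS Z) F ∧ phase (heartCharge hS Z) F = t ∧ t ∈ U) a X) :
    HasFiltration IsZero TriangleStep
      (fun t F => t - m ∈ U ∧ slicing hS Z t F ∧ ¬ IsZero F ∧ t ≤ m + 1) (a + m) (X.obj⟦m⟧) := by
  induction h with
  | zero b Y hY =>
    exact .zero _ _ (Functor.map_isZero _ ((isZero_fullSubcategory_iff _ _).1 hY))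
  | step b t Y X F hR hG hb hY ih =>
    obtain ⟨f, g, w, hS'⟩ := hR
    obtain ⟨h, hT⟩ := hS.distTriang_of_shortExact hS'
    refine .step _ (t + m) (Y.obj⟦m⟧) _ (F.obj⟦m⟧)
      ⟨_, _, _, Triangle.shift_distinguished _ hT m⟩ ⟨?_, ?_, ?_, ?_⟩ (by linarith) ih
    · simpa using hG.2.2
    · exact slicing_of_isSemistable hS hZ hG.1 hG.2.1 m
    · intro h0
      refine hG.1.1 ((isZero_fullSubcategory_iff _ _).2 ?_)
      exact (Functor.map_isZero (shiftFunctor C (-m)) h0).of_iso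
        ((shiftFunctorCompIsoId C m (-m) (by simp)).app F.obj).symm
    · have := phase_le_one (heartCharge hS Z) F
      rw [hG.2.1] at this
      linarith

include hZ hrk in
lemma hasFiltration_shift {U : Set ℝ} (hU : IsLowerSet U) (m : ℤ) {X : C} {a : ℝ}
    (hX : phaseBounded hS Z U (Set.Ioi a) (X⟦-m⟧)) :
    HasFiltration IsZero TriangleStep
      (fun t F => t - m ∈ U ∧ slicing hS Z t F ∧ ¬ IsZero F ∧ t ≤ m + 1) (a + m) X := by
  let := hS.abelianHeart
  obtain ⟨hX, h₁, h₂⟩ := hX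
  have h := (isStabilityFunction_heartCharge hS hZ).exists_hasFiltration
    (heartLength_pos hS hrk) (finite_heartCharge hS hrk) hU ⟨_, hX⟩ a h₁ h₂
  exact (hasFiltration_shift_of_heart hS hZ m h).of_iso
    ((shiftFunctorCompIsoId C (-m) m (by simp)).app X)

include hZ hrk in
lemma hasFiltration_of_extensionClosure_singleton {m : ℤ} {X : C}
    (hX : extensionClosure (shiftsIn S {m}) X) :
    HasFiltration IsZero TriangleStep
      (fun t F => slicing hS Z t F ∧ ¬ IsZero F ∧ t ≤ m + 1) m X := by
  let := hS.abelianHeart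
  have := hasFiltration_shift hS hZ hrk isLowerSet_univ m (X := X) (a := 0)
    ⟨heart_of_shift (by simp) hX, fun _ _ _ _ => trivial, fun _ _ _ h =>
      (isStabilityFunction_heartCharge hS hZ).phase_pos h⟩
  rw [zero_add] at this
  exact this.imp fun _ _ h => h.2

include hZ hrk in
-- Sorting splits off the part in the top shift `l + n + 1`. Its phases exceed `l + n + 1` while
-- those of the rest do not, so the two filtrations can be spliced.
lemma hasFiltration_of_extensionClosure_Icc (l : ℤ) (n : ℕ) {X : C}
    (hX : extensionClosure (shiftsIn S (Set.Icc l (l + n))) X) :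
    HasFiltration IsZero TriangleStep
      (fun t F => t ≤ l + n + 1 ∧ slicing hS Z t F ∧ ¬ IsZero F) l X := by
  induction n generalizing X with
  | zero =>
    simp only [Nat.cast_zero, add_zero, Set.Icc_self] at hX
    refine (hasFiltration_of_extensionClosure_singleton hS hZ hrk hX).imp fun t F h => ?_
    exact ⟨by simpa using h.2.2, h.1, h.2.1⟩
  | succ n ih =>
    have hI : Set.Icc l (l + (n + 1 : ℕ)) = {l + n + 1} ∪ Set.Icc l (l + n) := by
      ext i
      simp only [Set.mem_Icc, Set.mem_union, Set.mem_singleton_iff]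
      push_cast
      lia
    rw [hI] at hX
    obtain ⟨X₁, X₃, f, g, h, hT, h₁, h₃⟩ := hS.extensionClosure_shiftsIn_union_le (by
      intro i hi j hj
      simp only [Set.mem_singleton_iff, Set.mem_Icc] at hi hj
      lia) _ hX
    have h₁ := hasFiltration_of_extensionClosure_singleton hS hZ hrk h₁
    refine HasFiltration.append (c := l + n + 1) (by linarith [Nat.cast_nonneg (α := ℝ) n])
      ⟨f, g, h, hT⟩ ?_ ((ih h₃).imp fun t F h => ?_)
    · push_cast at h₁
      refine h₁.imp fun t F h => ⟨?_, h.1, h.2.1⟩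
      push_cast
      linarith [h.2.2]
    · refine ⟨h.1, ?_, h.2⟩
      push_cast
      linarith [h.1]

include hZ hrk in
lemma slicing_exists_HN (X : C) : ∃ (n : ℕ) (B : Fin (n + 1) → C)
    (F : Fin n → C) (φ : Fin n → ℝ), IsZero (B 0) ∧ Nonempty (B (Fin.last n) ≅ X) ∧
    (∀ a : Fin n, ∃ (f : B a.castSucc ⟶ B a.succ) (g : B a.succ ⟶ F a)
      (h : F a ⟶ (B a.castSucc)⟦(1 : ℤ)⟧), Triangle.mk f g h ∈ distTriang C) ∧
    (∀ a : Fin n, slicing hS Z (φ a) (F a) ∧ ¬ IsZero (F a)) ∧ StrictAnti φ := by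
  obtain ⟨N, hN⟩ := hS.exists_extensionClosure_shiftsIn X
  have h : Set.Icc (-N : ℤ) N = Set.Icc (-N : ℤ) (-N + (2 * N : ℕ)) := by
    congr 1; push_cast; ring
  rw [h] at hN
  obtain ⟨n, B, F, φ, h0, h1, h2, h3, h4, -⟩ :=
    (hasFiltration_of_extensionClosure_Icc hS hZ hrk _ _ hN).exists_fin
  exact ⟨n, B, F, φ, h0, ⟨eqToIso h1⟩, h2, fun a => (h3 a).2, h4⟩

end Slicing

/-! ### Local finiteness and the stability condition of a charge. -/

section Construction

variable {C : Type u} [Category.{v} C] [Preadditive C] [HasZeroObject C] [HasShift C ℤ]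
  [∀ m : ℤ, (shiftFunctor C m).Additive] [Pretriangulated C]
  {ι : Type w} {S : ι → C} [IsTriangulated C] (hS : IsSimpleMinded S) {Z : TriK C →+ ℂ}
  (hZ : ∀ a, Z (TriK.cls (S a)) ∈ halfPlane)
  [DecidableEq ι] [Fintype ι] {rk : TriK C →+ (ι → ℤ)} (hrk : IsRankFunction S rk)

include hZ in
-- A nonzero semistable object of phase in `(m + 1, m + 1 + φ)` would come from one in the heart of
-- phase below `φ`. Hence the interval meets only one shift of the heart, although it may extend
-- beyond `m + 1`.
lemma phaseBounded_of_intervalSubcategory {φ : ℝ}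
    (hφ : ∀ X : (heart S).FullSubcategory, ¬ IsZero X → φ ≤ phase (heartCharge hS Z) X)
    {l r : ℝ} {m : ℤ} (hl : m ≤ l) (hr : r ≤ m + 1 + φ) (hφ₁ : φ ≤ 1) {X : C}
    (hX : intervalSubcategory (slicing hS Z) (Set.Ioo l r) X) :
    phaseBounded hS Z (Set.Iio (r - m)) (Set.Ioi (l - m)) (X⟦-m⟧) := by
  let := hS.abelianHeart
  induction hX with
  | of X hX =>
    obtain ⟨t, ⟨ht, ht'⟩, hX⟩ := hX
    by_cases h0 : IsZero X
    · exact phaseBounded_of_isZero hS _ _ (Functor.map_isZero _ h0)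
    · by_cases h1 : t - m ≤ 1
      · rw [slicing_iff (m := m) hS Z (by linarith) h1, heartSlice_eq hS hZ] at hX
        obtain ⟨h, h₁, h₂⟩ := hX
        exact ⟨h, h₁.mono (Set.Iic_subset_Iio.2 (by linarith)),
          h₂.mono (Set.Ici_subset_Ioi.2 (by linarith))⟩
      · rw [slicing_iff (m := m + 1) hS Z (by push_cast; linarith) (by push_cast; linarith)] at hX
        obtain ⟨h, h' | ⟨h', ht⟩⟩ := hX
        · exact absurd ((Functor.map_isZero (shiftFunctor C (m + 1)) h').of_iso
            ((shiftFunctorCompIsoId C (-(m + 1)) (m + 1) (by simp)).app X).symm) h0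
        · have := hφ _ h'.1
          rw [ht] at this
          push_cast at this
          linarith
  | zero X hX => exact phaseBounded_of_isZero hS _ _ (Functor.map_isZero _ hX)
  | ext T hT h₁ h₃ ih₁ ih₃ =>
    exact phaseBounded_of_distTriang hS hZ (Triangle.shift_distinguished T hT (-m)) ih₁ ih₃

include hZ hrk in
lemma intervalSubcategory_of_phaseBounded {l r : ℝ} {m : ℤ} {X : C}
    (hX : phaseBounded hS Z (Set.Iio (r - m)) (Set.Ioi (l - m)) (X⟦-m⟧)) :
    intervalSubcategory (slicing hS Z) (Set.Ioo l r) X := by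
  have h := hasFiltration_shift hS hZ hrk (isLowerSet_Iio (r - m)) m hX
  rw [sub_add_cancel] at h
  have key : ∀ b X, HasFiltration IsZero TriangleStep (fun t F => t - m ∈ Set.Iio (r - (m : ℝ)) ∧
      slicing hS Z t F ∧ ¬ IsZero F ∧ t ≤ m + 1) b X → l ≤ b →
      intervalSubcategory (slicing hS Z) (Set.Ioo l r) X := by
    intro b X h hb
    induction h with
    | zero b X hX => exact .zero X hX
    | step b t Y X F hR hG hbt hY ih =>
      obtain ⟨f, g, k, hT⟩ := hR
      have ht : t < r := by
        have := hG.1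
        simp only [Set.mem_Iio] at this
        linarith
      exact .ext _ hT (ih (by linarith)) (.of _ ⟨t, ⟨by linarith, ht⟩, hG.2.1⟩)
  exact key _ _ h le_rfl

include hZ hrk in
lemma slicing_locallyFinite : ∃ η : ℝ, 0 < η ∧ η < 1 / 2 ∧ ∀ t : ℝ,
    IsFiniteLengthCategory
      (intervalSubcategory (slicing hS Z) (Set.Ioo (t - η) (t + η))).FullSubcategory := by
  obtain ⟨φ, h0, h1, hφ⟩ := exists_phase_lower_bound hS hZ
  -- The interval has width `φ / 2`. With `m` the floor of its left end, its right end is below `m +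
  -- 1 + φ`, and `φ ≤ 1` gives `φ / 4 < 1 / 2`.
  refine ⟨φ / 4, by linarith, by linarith, fun t => ?_⟩
  let := hS.abelianHeart
  let m : ℤ := ⌊t - φ / 4⌋
  have hm : (m : ℝ) ≤ t - φ / 4 := Int.floor_le _
  have hm' : t - φ / 4 < m + 1 := Int.lt_floor_add_one _
  have hb : ∀ X : (intervalSubcategory (slicing hS Z)
      (Set.Ioo (t - φ / 4) (t + φ / 4))).FullSubcategory, phaseBounded hS Z
      (Set.Iio (t + φ / 4 - m)) (Set.Ioi (t - φ / 4 - m)) ((X.obj)⟦-m⟧) := fun X =>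
    phaseBounded_of_intervalSubcategory hS hZ hφ hm (by linarith) h1 X.property
  let Φ := (heart S).lift ((intervalSubcategory (slicing hS Z)
    (Set.Ioo (t - φ / 4) (t + φ / 4))).ι ⋙ shiftFunctor C (-m)) fun X => (hb X).1
  refine isFiniteLengthCategory_of_fullyFaithful Φ (heartLength_pos hS hrk) ?_
  intro X Y f
  obtain ⟨hX, -, hX'⟩ := hb X
  obtain ⟨hY, hY', -⟩ := hb Y
  have hX'' : QuotPhases (heartCharge hS Z) (Set.Ioi (t - φ / 4 - m)) (Φ.obj X) := hX'
  have hY'' : SubPhases (heartCharge hS Z) (Set.Iio (t + φ / 4 - m)) (Φ.obj Y) := hY'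
  -- The image inherits the upper bound as a subobject of the target and the lower bound as a
  -- quotient of the source, so it comes from the interval subcategory.
  have hI : phaseBounded hS Z (Set.Iio (t + φ / 4 - m)) (Set.Ioi (t - φ / 4 - m))
      (image (Φ.map f)).obj :=
    ⟨(image (Φ.map f)).property, hY''.of_mono (image.ι (Φ.map f)),
      hX''.of_epi (factorThruImage (Φ.map f))⟩
  let e : ((image (Φ.map f)).obj⟦m⟧)⟦-m⟧ ≅ (image (Φ.map f)).obj :=
    (shiftFunctorCompIsoId C m (-m) (by simp)).app _
  exact ⟨⟨(image (Φ.map f)).obj⟦m⟧, intervalSubcategory_of_phaseBounded hS hZ hrk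
    (prop_of_iso _ e.symm hI)⟩, ⟨(heart S).fullyFaithfulι.preimageIso e⟩⟩

/-- The stability condition with given central charge on the heart generated by a simple-minded
collection. -/
noncomputable def stabilityOfCharge : StabilityCondition C where
  P := slicing hS Z
  Z := Z
  closedUnderIso t := (slicing_closed hS hZ t).1
  closedUnderSums t := (slicing_closed hS hZ t).2
  shift_iff t X := by simpa using slicing_shift_iff hS hZ t X 1
  hom_eq_zero t₁ t₂ h X₁ X₂ h₁ h₂ f := slicing_hom_eq_zero hS hZ h h₁ h₂ f
  exists_HN X _ := slicing_exists_HN hS hZ hrk X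
  central_charge t X hX h0 := slicing_central_charge hS hZ hX h0
  locallyFinite := slicing_locallyFinite hS hZ hrk

lemma stabilityOfCharge_mem : stabilityOfCharge hS hZ hrk ∈ collectionFamily S := by
  let := hS.abelianHeart
  refine ⟨heartCharge hS Z, isStabilityFunction_heartCharge hS hZ,
    (isStabilityFunction_heartCharge hS hZ).hasHNProperty (heartLength_pos hS hrk)
      (finite_heartCharge hS hrk), fun X => (heartCharge_cls hS X).symm, fun t h₀ h₁ X => ?_⟩
  change slicing hS Z t X ↔ heartSlice hS Z t X
  rw [slicing_iff (m := 0) hS Z (by simpa using h₀) (by simpa using h₁)]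
  simp only [Int.cast_zero, sub_zero, neg_zero]
  exact ⟨heartSlice_of_iso hS hZ ((shiftFunctorZero C ℤ).app X),
    heartSlice_of_iso hS hZ ((shiftFunctorZero C ℤ).app X).symm⟩

end Construction

/-! ### A stability condition is determined by its heart and charge. -/

section Uniqueness

variable {C : Type u} [Category.{v} C] [Preadditive C] [HasZeroObject C] [HasShift C ℤ]
  [∀ m : ℤ, (shiftFunctor C m).Additive] [Pretriangulated C]

lemma StabilityCondition.prop_shift_iff (σ : StabilityCondition C) (t : ℝ) (m : ℤ) (X : C) :
    σ.P (t + m) (X⟦m⟧) ↔ σ.P t X := by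
  have hiso := fun t => σ.closedUnderIso t
  induction m using Int.induction_on with
  | zero =>
    simp only [Int.cast_zero, add_zero]
    exact (σ.P t).prop_iff_of_iso ((shiftFunctorZero C ℤ).app X)
  | succ m ih =>
    refine Iff.trans ?_ ih
    rw [← σ.shift_iff (t + ((m : ℤ) : ℝ))]
    have : t + (((m : ℤ) + 1 : ℤ) : ℝ) = t + ((m : ℤ) : ℝ) + 1 := by push_cast; ring
    rw [this]
    exact prop_iff_of_iso _ ((shiftFunctorAdd C (m : ℤ) 1).app X)
  | pred m ih =>
    refine Iff.trans ?_ ih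
    rw [← σ.shift_iff]
    have : t + ((-(m : ℤ) - 1 : ℤ) : ℝ) + 1 = t + ((-(m : ℤ) : ℤ) : ℝ) := by push_cast; ring
    rw [this]
    exact prop_iff_of_iso _ ((shiftFunctorAdd' C (-(m : ℤ) - 1) 1 (-(m : ℤ)) (by lia)).app X).symm

lemma StabilityCondition.prop_iff_shift (σ : StabilityCondition C) (t : ℝ) (m : ℤ) (X : C) :
    σ.P t X ↔ σ.P (t - m) (X⟦-m⟧) := by
  rw [← σ.prop_shift_iff t (-m) X]
  push_cast
  rw [sub_eq_add_neg]

/-- A stability condition in `heartFamily A` is determined by its central charge. -/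
lemma eq_of_mem_heartFamily {A : ObjectProperty C} {σ τ : StabilityCondition C}
    (hσ : σ ∈ heartFamily A) (hτ : τ ∈ heartFamily A) (h : σ.Z = τ.Z) : σ = τ := by
  obtain ⟨Z, -, -, hZ, hP⟩ := hσ
  obtain ⟨Z', -, -, hZ', hP'⟩ := hτ
  have hZZ' : Z = Z' := by
    ext X
    change Z (AbK.cls X) = Z' (AbK.cls X)
    rw [← hZ, ← hZ', h]
  subst hZZ'
  refine StabilityCondition.ext (funext fun t => ?_) h
  ext X
  obtain ⟨m, h₀, h₁⟩ := exists_slicing_index t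
  rw [σ.prop_iff_shift t m, τ.prop_iff_shift t m, hP _ h₀ h₁, hP' _ h₀ h₁]

end Uniqueness

/-! ### Semiorthogonal decompositions and additive functions. -/

section Semiorthogonal

variable {C : Type u} [Category.{v} C] [Preadditive C] [HasZeroObject C] [HasShift C ℤ]
  [∀ m : ℤ, (shiftFunctor C m).Additive] [Pretriangulated C]

instance (G : ObjectProperty C) : (triangulatedHull G).IsClosedUnderIsomorphisms where
  of_iso {X Y} e hX := by
    refine triangulatedHull.ext (Triangle.mk e.hom (0 : Y ⟶ 0) 0) ?_ hX
      (triangulatedHull.zero _ (isZero_zero C))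
    exact distinguished_mk_of_iso (contractible_distinguished X) (Iso.refl _) e.symm (Iso.refl _)
      (by simp) (by simp) (by simp)

/-- The shifted triangle carries the sign `(-1)^l` on all its maps. Multiplying the middle object by
this sign removes it from the first two, and the third map absorbs what remains. -/
lemma exists_shift_distinguished {T : Triangle C} (hT : T ∈ distTriang C) (l : ℤ) :
    ∃ d : T.obj₃⟦l⟧ ⟶ (T.obj₁⟦l⟧)⟦(1 : ℤ)⟧,
      Triangle.mk (T.mor₁⟦l⟧') (T.mor₂⟦l⟧') d ∈ distTriang C := by
  let e : T.obj₂⟦l⟧ ≅ T.obj₂⟦l⟧ :=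
    { hom := l.negOnePow • 𝟙 _
      inv := l.negOnePow • 𝟙 _
      hom_inv_id := by
        rw [Linear.units_smul_comp, Linear.comp_units_smul, smul_smul, Int.units_mul_self, one_smul,
          Category.comp_id]
      inv_hom_id := by
        rw [Linear.units_smul_comp, Linear.comp_units_smul, smul_smul, Int.units_mul_self, one_smul,
          Category.comp_id] }
  refine ⟨l.negOnePow • (T.mor₃⟦l⟧' ≫ (shiftFunctorComm C 1 l).hom.app T.obj₁),
    distinguished_mk_of_iso (f' := T.mor₁⟦l⟧') (Triangle.shift_distinguished T hT l)
      (Iso.refl _) e (Iso.refl _) ?_ ?_ ?_⟩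
  · simp [e, Linear.comp_units_smul]
  · simp [e, Linear.units_smul_comp, smul_smul]
  · simp

lemma hom_eq_zero_of_triangulatedHull_right {G : ObjectProperty C} {X : C}
    (h : ∀ Y, G Y → ∀ (l : ℤ) (f : X ⟶ Y⟦l⟧), f = 0) {Y : C} (hY : triangulatedHull G Y) :
    ∀ (l : ℤ) (f : X ⟶ Y⟦l⟧), f = 0 := by
  induction hY with
  | of Y hY => exact h Y hY
  | zero Y hY => exact fun l f => (Functor.map_isZero (shiftFunctor C l) hY).eq_of_tgt _ _
  | shift Y a hY ih =>
    intro l f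
    rw [← cancel_mono ((shiftFunctorAdd C a l).inv.app Y), zero_comp]
    exact ih (a + l) _
  | ext T hT h₁ h₃ ih₁ ih₃ =>
    intro l f
    obtain ⟨d, hd⟩ := exists_shift_distinguished hT l
    obtain ⟨(g : _ ⟶ T.obj₁⟦l⟧), hg : f = g ≫ T.mor₁⟦l⟧'⟩ := Triangle.coyoneda_exact₂ _ hd f (ih₃ l _)
    rw [hg, ih₁ l g, zero_comp]

lemma hom_eq_zero_of_triangulatedHull {G H : ObjectProperty C}
    (h : ∀ X Y, G X → H Y → ∀ (l : ℤ) (f : X ⟶ Y⟦l⟧), f = 0) {X Y : C}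
    (hX : triangulatedHull G X) (hY : triangulatedHull H Y) (f : X ⟶ Y) : f = 0 := by
  suffices H : ∀ (l : ℤ) (f : X⟦l⟧ ⟶ Y), f = 0 by
    rw [← cancel_epi ((shiftFunctorZero C ℤ).hom.app X), comp_zero]
    exact H 0 _
  clear f
  induction hX with
  | of X hX =>
    intro l f
    have := hom_shift_eq_zero (m := l) (l := 0) (n := -l) (by simp)
      (hom_eq_zero_of_triangulatedHull_right (fun Y hY => h X Y hX hY) hY (-l))
      (f ≫ (shiftFunctorZero C ℤ).inv.app Y)
    rw [← cancel_mono ((shiftFunctorZero C ℤ).inv.app Y), zero_comp]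
    exact this
  | zero X hX => exact fun l f => (Functor.map_isZero (shiftFunctor C l) hX).eq_of_src _ _
  | shift X a hX ih =>
    intro l f
    rw [← cancel_epi ((shiftFunctorAdd C a l).hom.app X), comp_zero]
    exact ih (a + l) _
  | ext T hT h₁ h₃ ih₁ ih₃ =>
    intro l f
    obtain ⟨d, hd⟩ := exists_shift_distinguished hT l
    obtain ⟨(g : T.obj₃⟦l⟧ ⟶ _), hg : f = T.mor₂⟦l⟧' ≫ g⟩ := Triangle.yoneda_exact₂ _ hd f (ih₁ l _)
    rw [hg, ih₃ l g, comp_zero]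

/-- `X'` is the component in `Q` of a decomposition of `X` into objects of `P` and `Q`. -/
def IsComponent (P Q : ObjectProperty C) (X X' : C) : Prop :=
  Q X' ∧ ∃ Y, P Y ∧ TriangleStep Y X X'

variable {P Q : ObjectProperty C} [P.IsTriangulated] [Q.IsTriangulated]
  [P.IsClosedUnderIsomorphisms] [Q.IsClosedUnderIsomorphisms]

lemma isComponent_self {X : C} (hX : Q X) : IsComponent P Q X X :=
  ⟨hX, 0, P.prop_zero, _, _, _, contractible_distinguished₁ X⟩

lemma isComponent_zero {X : C} (hX : P X) : IsComponent P Q X 0 :=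
  ⟨Q.prop_zero, X, hX, _, _, _, contractible_distinguished X⟩

lemma IsComponent.shift {X X' : C} (h : IsComponent P Q X X') (a : ℤ) :
    IsComponent P Q (X⟦a⟧) (X'⟦a⟧) := by
  obtain ⟨hX', Y, hY, f, g, k, hT⟩ := h
  exact ⟨Q.le_shift a _ hX', _, P.le_shift a _ hY, _, _, _, Triangle.shift_distinguished _ hT a⟩

variable [IsTriangulated C] (hPQ : ∀ X Y, P X → Q Y → ∀ f : X ⟶ Y, f = 0)
include hPQ

/-- Components of the objects of a distinguished triangle can be put into a distinguished
triangle. -/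
lemma IsComponent.exists_triangle {T : Triangle C} (hT : T ∈ distTriang C) {X' Y' : C}
    (hX : IsComponent P Q T.obj₁ X') (hY : IsComponent P Q T.obj₂ Y') :
    ∃ Z', IsComponent P Q T.obj₃ Z' ∧ TriangleStep X' Y' Z' := by
  obtain ⟨hX', A, hA, a, p, a', hA'⟩ := hX
  obtain ⟨hY', B, hB, b, q, b', hB'⟩ := hY
  -- Orthogonality kills `A ⟶ Y'`, so the map to `Y'` factors through `X'`.
  obtain ⟨u, hu⟩ : ∃ u : X' ⟶ Y', T.mor₁ ≫ q = p ≫ u :=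
    Triangle.yoneda_exact₂ _ hA' (T.mor₁ ≫ q) (hPQ _ _ hA hY' _)
  obtain ⟨V, v, v', hV⟩ := distinguished_cocone_triangle (T.mor₁ ≫ q)
  obtain ⟨W, w, w', hW⟩ := distinguished_cocone_triangle u
  let o₁ := Triangulated.someOctahedron hu.symm (rot_of_distTriang _ hA') hW hV
  have hB'' : Triangle.mk q b' (-b⟦(1 : ℤ)⟧') ∈ distTriang C := rot_of_distTriang _ hB'
  let o₂ := Triangulated.someOctahedron (u₁₂ := T.mor₁) (v₁₂ := T.mor₂) (w₁₂ := T.mor₃) rfl hT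
    hB'' hV
  -- The composite `T.obj₃ ⟶ V ⟶ W` passes through the cone `V` of `T.obj₁ ⟶ Y'`. Its two factors
  -- have cones `B[1]` and `A[2]`, so its own cone `G` is an extension of objects of `P`, and `W` is
  -- the component of `T.obj₃`.
  obtain ⟨G, g, g', hG⟩ := distinguished_cocone_triangle (o₂.m₁ ≫ o₁.m₃)
  let o₃ := Triangulated.someOctahedron rfl o₂.mem (rot_of_distTriang _ o₁.mem) hG
  have hG' : P G := P.ext_of_isTriangulatedClosed₂ _ o₃.mem (P.le_shift 1 _ hB)
    (P.le_shift 1 _ (P.le_shift 1 _ hA))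
  exact ⟨W, ⟨Q.ext_of_isTriangulatedClosed₃ _ hW hX' hY', _, P.le_shift (-1) _ hG', _, _, _,
    inv_rot_of_distTriang _ hG⟩, u, w, w', hW⟩

lemma exists_isComponent {G : ObjectProperty C} (hG : ∀ X, G X → P X ∨ Q X) {X : C}
    (hX : triangulatedHull G X) : ∃ X', IsComponent P Q X X' := by
  induction hX with
  | of X hX =>
    rcases hG X hX with h | h
    · exact ⟨_, isComponent_zero h⟩
    · exact ⟨_, isComponent_self h⟩
  | zero X hX => exact ⟨_, isComponent_self (Q.prop_of_isZero hX)⟩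
  | shift X a hX ih =>
    obtain ⟨X', h⟩ := ih
    exact ⟨_, h.shift a⟩
  | ext T hT h₁ h₃ ih₁ ih₃ =>
    obtain ⟨X', hX'⟩ := ih₁
    obtain ⟨Z', hZ'⟩ := ih₃
    obtain ⟨Y', hY', -⟩ := IsComponent.exists_triangle hPQ (inv_rot_of_distTriang _ hT)
      (hZ'.shift (-1)) hX'
    exact ⟨Y', hY'⟩

/-- An additive function on the right part of a semiorthogonal decomposition extends to the
Grothendieck group. -/
lemma exists_extend_additive (hdec : ∀ X, ∃ X', IsComponent P Q X X') (χ : C → ℤ)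
    (hχ : ∀ T ∈ distTriang C, Q T.obj₁ → Q T.obj₂ → Q T.obj₃ → χ T.obj₂ = χ T.obj₁ + χ T.obj₃) :
    ∃ d : TriK C →+ ℤ, ∀ X X', IsComponent P Q X X' → d (TriK.cls X) = χ X' := by
  have hstep : ∀ X Y Z, Q X → Q Y → Q Z → TriangleStep X Y Z → χ Y = χ X + χ Z := by
    rintro X Y Z hX hY hZ ⟨f, g, h, hT⟩
    exact hχ _ hT hX hY hZ
  have hzero : ∀ X, IsZero X → χ X = 0 := by
    intro X hX
    have h : Triangle.mk (0 : X ⟶ X) (0 : X ⟶ X) 0 ∈ distTriang C :=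
      distinguished_mk_of_iso (contractible_distinguished X) (Iso.refl _) (Iso.refl _)
        (hX.iso (isZero_zero C)) (hX.eq_of_src _ _) (hX.eq_of_src _ _) (hX.eq_of_src _ _)
    have hQ := Q.prop_of_isZero hX
    have := hstep X X X hQ hQ hQ ⟨_, _, _, h⟩
    lia
  -- The cone of the identity of `X` is zero. Its component `W` between `X'` and `X''` is isomorphic
  -- to an object of `P`, hence zero by orthogonality.
  have huniq : ∀ X X' X'', IsComponent P Q X X' → IsComponent P Q X X'' → χ X'' = χ X' := by
    intro X X' X'' h' h''
    obtain ⟨W, ⟨hW, A, hA, f, g, h, hT⟩, hs⟩ := IsComponent.exists_triangle hPQ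
      (contractible_distinguished X) h' h''
    have : IsIso h := (Triangle.isZero₂_iff_isIso₃ _ hT).1 (isZero_zero C)
    have hW0 : IsZero W := by
      rw [IsZero.iff_id_eq_zero, ← IsIso.hom_inv_id h,
        hPQ _ _ (P.le_shift 1 _ hA) hW (inv h), comp_zero]
    rw [hstep _ _ _ h'.1 h''.1 hW hs, hzero W hW0, add_zero]
  choose c hc using hdec
  have hrel : triRelations C ≤ (FreeAbelianGroup.lift fun X => χ (c X)).ker := by
    rw [triRelations, AddSubgroup.closure_le]
    rintro _ ⟨T, hT, rfl⟩
    obtain ⟨Z', hZ', hs⟩ := IsComponent.exists_triangle hPQ hT (hc T.obj₁) (hc T.obj₂)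
    have h₁ := hstep _ _ _ (hc _).1 (hc _).1 hZ'.1 hs
    have h₂ := huniq _ _ _ (hc T.obj₃) hZ'
    simp only [SetLike.mem_coe, AddMonoidHom.mem_ker, map_sub, FreeAbelianGroup.lift_apply_of]
    lia
  refine ⟨QuotientAddGroup.lift _ _ hrel, fun X X' h => ?_⟩
  change FreeAbelianGroup.lift (fun X => χ (c X)) (FreeAbelianGroup.of X) = _
  rw [FreeAbelianGroup.lift_apply_of]
  exact huniq _ _ _ h (hc X)

end Semiorthogonal

/-! ### Additivity of the Euler characteristic. -/

section EulerCharacteristic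

variable (k : Type w) [Field k] {C : Type u} [Category.{v} C] [Preadditive C] [Linear k C]
  [HasZeroObject C] [HasShift C ℤ] [∀ m : ℤ, (shiftFunctor C m).Additive] [Pretriangulated C]
  (E : C)

/-- All `Hom(E, X[l])` are finite-dimensional, and almost all are zero. -/
def HomFinite : ObjectProperty C := fun X =>
  (∀ l : ℤ, Module.Finite k (E ⟶ X⟦l⟧)) ∧ {l : ℤ | ∃ f : E ⟶ X⟦l⟧, f ≠ 0}.Finite

/-- The dimension of `Hom(E, X[l])`. -/
noncomputable def homDim (X : C) (l : ℤ) : ℕ := Module.finrank k (E ⟶ X⟦l⟧)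

/-- The Euler characteristic of `Hom(E, X[l])`, `l ∈ ℤ`. -/
noncomputable def eulerChar (X : C) : ℤ := ∑ᶠ l : ℤ, (l.negOnePow : ℤ) * homDim k E X l

lemma range_rightComp_eq_ker {X Y Z : C} {f : X ⟶ Y} {g : Y ⟶ Z} (w : f ≫ g = 0)
    (h : ∀ x : E ⟶ Y, x ≫ g = 0 → ∃ y : E ⟶ X, x = y ≫ f) :
    LinearMap.range (Linear.rightComp k E f) = LinearMap.ker (Linear.rightComp k E g) := by
  ext x
  constructor
  · rintro ⟨y, rfl⟩
    simp [w]
  · intro hx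
    obtain ⟨y, hy⟩ := h x hx
    exact ⟨y, hy.symm⟩

/-- Postcomposition with an isomorphism. -/
def rightCompEquiv {X Y : C} (e : X ≅ Y) : (E ⟶ X) ≃ₗ[k] (E ⟶ Y) :=
  LinearEquiv.ofLinearMap (Linear.rightComp k E e.hom) (Linear.rightComp k E e.inv)
    (by ext; simp) (by ext; simp)

lemma finite_of_exact {X Y Z : C} {f : X ⟶ Y} {g : Y ⟶ Z} (w : f ≫ g = 0)
    (h : ∀ x : E ⟶ Y, x ≫ g = 0 → ∃ y : E ⟶ X, x = y ≫ f)
    [Module.Finite k (E ⟶ X)] [Module.Finite k (E ⟶ Z)] : Module.Finite k (E ⟶ Y) := by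
  have h₁ : Module.Finite k (LinearMap.ker (Linear.rightComp k E g)) := by
    rw [← range_rightComp_eq_ker k E w h]
    infer_instance
  have h₂ : Module.Finite k (LinearMap.range (Linear.rightComp k E g)) := inferInstance
  have : Module.Finite k ((E ⟶ Y) ⧸ LinearMap.ker (Linear.rightComp k E g)) :=
    Module.Finite.equiv (LinearMap.quotKerEquivRange (Linear.rightComp k E g)).symm
  exact .of_submodule_quotient (LinearMap.ker (Linear.rightComp k E g))

lemma HomFinite.of_triangulatedHull {G : ObjectProperty C} (hG : G ≤ HomFinite k E) :
    triangulatedHull G ≤ HomFinite k E := by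
  intro X hX
  induction hX with
  | of X hX => exact hG X hX
  | zero X hX =>
    have h : ∀ (l : ℤ) (f : E ⟶ X⟦l⟧), f = 0 := fun l f =>
      (Functor.map_isZero (shiftFunctor C l) hX).eq_of_tgt _ _
    refine ⟨fun l => ?_, ?_⟩
    · have : Subsingleton (E ⟶ X⟦l⟧) := ⟨fun f g => (h l f).trans (h l g).symm⟩
      infer_instance
    · convert Set.finite_empty
      ext l
      simpa using h l
  | shift X a hX ih =>
    refine ⟨fun l => ?_, ?_⟩
    · have := ih.1 (a + l)
      exact Module.Finite.equiv (rightCompEquiv k E ((shiftFunctorAdd C a l).app X))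
    · refine (ih.2.preimage (f := fun l => a + l) (add_right_injective a).injOn).subset ?_
      rintro l ⟨f, hf⟩
      refine ⟨f ≫ (shiftFunctorAdd C a l).inv.app X, fun h => hf ?_⟩
      rwa [← cancel_mono ((shiftFunctorAdd C a l).inv.app X), zero_comp]
  | ext T hT h₁ h₃ ih₁ ih₃ =>
    refine ⟨fun l => ?_, ?_⟩
    · have := ih₁.1 l
      have := ih₃.1 l
      obtain ⟨d, hd⟩ := exists_shift_distinguished hT l
      exact finite_of_exact k E (f := T.mor₁⟦l⟧') (g := T.mor₂⟦l⟧') (comp_distTriang_mor_zero₁₂ _ hd)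
        (Triangle.coyoneda_exact₂ _ hd)
    · refine (ih₁.2.union ih₃.2).subset ?_
      rintro l ⟨f, hf⟩
      by_contra! h
      have h₁ : ∀ f : E ⟶ T.obj₁⟦l⟧, f = 0 := fun f => by
        by_contra hf
        exact h (Or.inl ⟨f, hf⟩)
      have h₃ : ∀ f : E ⟶ T.obj₃⟦l⟧, f = 0 := fun f => by
        by_contra hf
        exact h (Or.inr ⟨f, hf⟩)
      obtain ⟨d, hd⟩ := exists_shift_distinguished hT l
      obtain ⟨(g : _ ⟶ T.obj₁⟦l⟧), hg : f = g ≫ T.mor₁⟦l⟧'⟩ := Triangle.coyoneda_exact₂ _ hd f (h₃ _)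
      exact hf (by rw [hg, h₁ g, zero_comp])

/-- The alternating sum of the dimensions of a bounded long exact sequence. -/
lemma finsum_negOnePow_eq_add {x y z f g d : ℤ → ℕ} (hy : ∀ l, g l + f l = y l)
    (hz : ∀ l, d l + g l = z l) (hx : ∀ l, f (l + 1) + d l = x (l + 1))
    (hy₀ : (Function.support y).Finite) (hz₀ : (Function.support z).Finite) :
    ∑ᶠ l : ℤ, (l.negOnePow : ℤ) * y l =
      ∑ᶠ l : ℤ, (l.negOnePow : ℤ) * x l + ∑ᶠ l : ℤ, (l.negOnePow : ℤ) * z l := by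
  have hx' : ∀ l, x l = f l + d (l - 1) := fun l => by
    have := hx (l - 1)
    rw [sub_add_cancel] at this
    exact this.symm
  have hs : ∀ u v : ℤ → ℕ, (∀ l, u l ≤ v l) → (Function.support v).Finite →
      (Function.support fun l : ℤ => (l.negOnePow : ℤ) * u l).Finite := by
    intro u v huv hv
    refine hv.subset fun l hl => ?_
    simp only [Function.mem_support, ne_eq, mul_eq_zero, not_or] at hl ⊢
    have := huv l
    have h2 := hl.2
    intro h0
    apply h2
    have : u l = 0 := by lia
    simp [this]
  have hf := hs f y (fun l => by have := hy l; lia) hy₀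
  have hg := hs g y (fun l => by have := hy l; lia) hy₀
  have hd := hs d z (fun l => by have := hz l; lia) hz₀
  have hd' : (Function.support fun l : ℤ => (l.negOnePow : ℤ) * d (l - 1)).Finite := by
    refine (hd.image fun l => l + 1).subset fun l hl => ⟨l - 1, ?_, by simp⟩
    simpa using hl
  -- The ranks of the connecting maps enter `x` one degree later than `z`, so they carry opposite
  -- signs and cancel.
  have hshift : ∑ᶠ l : ℤ, (l.negOnePow : ℤ) * d (l - 1) =
      -∑ᶠ l : ℤ, (l.negOnePow : ℤ) * d l := by
    rw [← finsum_comp_equiv (Equiv.addRight (1 : ℤ)), ← finsum_neg_distrib]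
    refine finsum_congr fun l => ?_
    simp [Int.negOnePow_succ]
  have e₁ : ∑ᶠ l : ℤ, (l.negOnePow : ℤ) * y l =
      ∑ᶠ l : ℤ, (l.negOnePow : ℤ) * g l + ∑ᶠ l : ℤ, (l.negOnePow : ℤ) * f l := by
    rw [← finsum_add_distrib hg hf]
    exact finsum_congr fun l => by rw [← hy]; push_cast; ring
  have e₂ : ∑ᶠ l : ℤ, (l.negOnePow : ℤ) * z l =
      ∑ᶠ l : ℤ, (l.negOnePow : ℤ) * d l + ∑ᶠ l : ℤ, (l.negOnePow : ℤ) * g l := by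
    rw [← finsum_add_distrib hd hg]
    exact finsum_congr fun l => by rw [← hz]; push_cast; ring
  have e₃ : ∑ᶠ l : ℤ, (l.negOnePow : ℤ) * x l =
      ∑ᶠ l : ℤ, (l.negOnePow : ℤ) * f l + ∑ᶠ l : ℤ, (l.negOnePow : ℤ) * d (l - 1) := by
    rw [← finsum_add_distrib hf hd']
    exact finsum_congr fun l => by rw [hx']; push_cast; ring
  rw [e₁, e₂, e₃, hshift]
  ring

lemma HomFinite.finite_support_homDim {X : C} (hX : HomFinite k E X) :
    (Function.support (homDim k E X)).Finite := by
  refine hX.2.subset fun l hl => ?_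
  by_contra h
  have h' : ∀ f : E ⟶ X⟦l⟧, f = 0 := fun f => by
    by_contra hf
    exact h ⟨f, hf⟩
  have : Subsingleton (E ⟶ X⟦l⟧) := ⟨fun f g => (h' f).trans (h' g).symm⟩
  exact hl (Module.finrank_zero_of_subsingleton)

/-- By exactness and rank-nullity, each dimension in the long exact sequence is the sum of the ranks
of the incoming and the outgoing map. The connecting map `D l` leads from degree `l` to `l + 1`. -/
lemma eulerChar_of_distTriang {T : Triangle C} (hT : T ∈ distTriang C)
    (h₁ : HomFinite k E T.obj₁) (h₂ : HomFinite k E T.obj₂) (h₃ : HomFinite k E T.obj₃) :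
    eulerChar k E T.obj₂ = eulerChar k E T.obj₁ + eulerChar k E T.obj₃ := by
  choose d hd using exists_shift_distinguished hT
  let F (l : ℤ) := Linear.rightComp k E (T.mor₁⟦l⟧')
  let G (l : ℤ) := Linear.rightComp k E (T.mor₂⟦l⟧')
  let D (l : ℤ) := Linear.rightComp k E (d l ≫ (shiftFunctorAdd C l 1).inv.app T.obj₁)
  have hFG (l : ℤ) : LinearMap.range (F l) = LinearMap.ker (G l) :=
    range_rightComp_eq_ker k E (comp_distTriang_mor_zero₁₂ _ (hd l))
      (Triangle.coyoneda_exact₂ _ (hd l))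
  have hGD (l : ℤ) : LinearMap.range (G l) = LinearMap.ker (D l) := by
    refine range_rightComp_eq_ker k E ?_ fun x hx => ?_
    · have : T.mor₂⟦l⟧' ≫ d l = 0 := comp_distTriang_mor_zero₂₃ _ (hd l)
      rw [← Category.assoc, this, zero_comp]
    · refine Triangle.coyoneda_exact₃ _ (hd l) x ?_
      change x ≫ d l = 0
      rw [← cancel_mono ((shiftFunctorAdd C l 1).inv.app T.obj₁), zero_comp, Category.assoc, hx]
  have hDF (l : ℤ) : LinearMap.range (D l) = LinearMap.ker (F (l + 1)) := by
    have hn : (shiftFunctorAdd C l 1).inv.app T.obj₁ ≫ T.mor₁⟦(l + 1)⟧' =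
        (T.mor₁⟦l⟧')⟦(1 : ℤ)⟧' ≫ (shiftFunctorAdd C l 1).inv.app T.obj₂ :=
      ((shiftFunctorAdd C l 1).inv.naturality T.mor₁).symm
    refine range_rightComp_eq_ker k E ?_ fun x hx => ?_
    · have : d l ≫ (T.mor₁⟦l⟧')⟦(1 : ℤ)⟧' = 0 := comp_distTriang_mor_zero₃₁ _ (hd l)
      rw [Category.assoc, hn, ← Category.assoc, this, zero_comp]
    · obtain ⟨(y : E ⟶ T.obj₃⟦l⟧), hy⟩ := Triangle.coyoneda_exact₁ _ (hd l)
        (x ≫ (shiftFunctorAdd C l 1).hom.app T.obj₁) (by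
          change (x ≫ (shiftFunctorAdd C l 1).hom.app T.obj₁) ≫ (T.mor₁⟦l⟧')⟦(1 : ℤ)⟧' = 0
          rw [← cancel_mono ((shiftFunctorAdd C l 1).inv.app T.obj₂), Category.assoc,
            Category.assoc, ← hn, Iso.hom_inv_id_app_assoc, hx, zero_comp])
      refine ⟨y, ?_⟩
      have hy' : x ≫ (shiftFunctorAdd C l 1).hom.app T.obj₁ = y ≫ d l := hy
      rw [← Category.assoc, ← hy', Category.assoc, Iso.hom_inv_id_app]
      exact (Category.comp_id x).symm
  refine finsum_negOnePow_eq_add (f := fun l => Module.finrank k (LinearMap.range (F l)))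
    (g := fun l => Module.finrank k (LinearMap.range (G l)))
    (d := fun l => Module.finrank k (LinearMap.range (D l))) (fun l => ?_) (fun l => ?_)
    (fun l => ?_) (HomFinite.finite_support_homDim k E h₂) (HomFinite.finite_support_homDim k E h₃)
  · have := h₂.1 l
    rw [hFG]
    exact (G l).finrank_range_add_finrank_ker
  · have := h₃.1 l
    rw [hGD]
    exact (D l).finrank_range_add_finrank_ker
  · have := h₁.1 (l + 1)
    change Module.finrank k (LinearMap.range (F (l + 1))) +
      Module.finrank k (LinearMap.range (D l)) = _
    rw [hDF]
    exact (F (l + 1)).finrank_range_add_finrank_ker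

end EulerCharacteristic

/-! ### Exceptional collections: simple-mindedness and multiplicities. -/

section Exceptional

variable {k : Type w} [Field k] {C : Type u} [Category.{v} C] [Preadditive C] [Linear k C]
  [HasZeroObject C] [HasShift C ℤ] [∀ m : ℤ, (shiftFunctor C m).Additive] [Pretriangulated C]

lemma eulerChar_eq_zero {X Y : C} (h : ∀ (l : ℤ) (f : X ⟶ Y⟦l⟧), f = 0) :
    eulerChar k X Y = 0 := by
  refine (finsum_congr fun l => ?_).trans finsum_zero
  have : Subsingleton (X ⟶ Y⟦l⟧) := ⟨fun f g => (h l f).trans (h l g).symm⟩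
  rw [homDim, Module.finrank_zero_of_subsingleton, Nat.cast_zero, mul_zero]

lemma homFinite_of_eq_zero {X Y : C} (h : ∀ l : ℤ, l ≠ 0 → ∀ f : X ⟶ Y⟦l⟧, f = 0)
    [Module.Finite k (X ⟶ Y)] : HomFinite k X Y := by
  refine ⟨fun l => ?_, (Set.finite_singleton 0).subset ?_⟩
  · by_cases hl : l = 0
    · subst hl
      exact Module.Finite.equiv (rightCompEquiv k X (X := Y) ((shiftFunctorZero C ℤ).app Y).symm)
    · have : Subsingleton (X ⟶ Y⟦l⟧) := ⟨fun f g => (h l hl f).trans (h l hl g).symm⟩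
      infer_instance
  · rintro l ⟨f, hf⟩
    by_contra hl
    exact hf (h l hl f)

lemma eulerChar_eq_finrank {X Y : C} (h : ∀ l : ℤ, l ≠ 0 → ∀ f : X ⟶ Y⟦l⟧, f = 0) :
    eulerChar k X Y = Module.finrank k (X ⟶ Y) := by
  rw [eulerChar, finsum_eq_single _ 0]
  · rw [(rightCompEquiv k X (X := Y) ((shiftFunctorZero C ℤ).app Y).symm).finrank_eq, homDim,
      Int.negOnePow_zero, Units.val_one, one_mul]
  · intro l hl
    have : Subsingleton (X ⟶ Y⟦l⟧) := ⟨fun f g => (h l hl f).trans (h l hl g).symm⟩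
    rw [homDim, Module.finrank_zero_of_subsingleton, Nat.cast_zero, mul_zero]

lemma hom_zero_shift_eq_zero {X Y : C} (h : ∀ f : X ⟶ Y⟦(0 : ℤ)⟧, f = 0) (f : X ⟶ Y) : f = 0 := by
  rw [← cancel_mono ((shiftFunctorZero C ℤ).inv.app Y), zero_comp]
  exact h _

namespace IsFullExtExceptional

variable {n : ℕ} {E : Fin (n + 1) → C} (hE : IsFullExtExceptional k E)
include hE

lemma not_isZero (a : Fin (n + 1)) : ¬ IsZero (E a) := by
  intro h
  have : Subsingleton (E a ⟶ E a) := ⟨fun f g => h.eq_of_src f g⟩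
  have := hE.end_eq a
  rw [Module.finrank_zero_of_subsingleton] at this
  exact zero_ne_one this

/-- Endomorphisms of a member are scalars, and degree-zero morphisms between different members
vanish because the Ext condition includes `l = 0`. -/
lemma isSimpleMinded : IsSimpleMinded E where
  hom_neg a b l hl f := by
    by_cases h : a = b
    · subst h
      exact hE.self_ext a l hl.ne f
    · exact hE.ext a b h l hl.le f
  eq_zero_or_isIso a b f := by
    by_cases h : a = b
    · subst h
      have h1 : (𝟙 (E a)) ≠ 0 := fun h => hE.not_isZero a ((IsZero.iff_id_eq_zero _).2 h)
      obtain ⟨c, rfl⟩ := (finrank_eq_one_iff_of_nonzero' (𝟙 (E a)) h1).1 (hE.end_eq a) f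
      by_cases hc : c = 0
      · exact Or.inl (by rw [hc, zero_smul])
      · exact Or.inr ⟨c⁻¹ • 𝟙 _, by simp [smul_smul, hc], by simp [smul_smul, hc]⟩
    · exact Or.inl (hom_zero_shift_eq_zero (hE.ext a b h 0 le_rfl) f)
  full := hE.full

/-- The homomorphism that counts the multiplicity of one member of the collection. -/
lemma exists_multiplicity [IsTriangulated C] (a : Fin (n + 1)) :
    ∃ d : TriK C →+ ℤ, ∀ b, d (TriK.cls (E b)) = if b = a then 1 else 0 := by
  -- There are no morphisms from members after `a` to shifts of those up to `a`. On the latter part,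
  -- `Hom(E_a, -)` sees only `E_a`, so its Euler characteristic is finite and counts copies of
  -- `E_a`; on `P` the component is zero.
  let P := triangulatedHull fun X => ∃ b, a < b ∧ X = E b
  let Q := triangulatedHull fun X => ∃ b, b ≤ a ∧ X = E b
  have hPQ : ∀ X Y, P X → Q Y → ∀ f : X ⟶ Y, f = 0 := fun X Y hX hY f => by
    refine hom_eq_zero_of_triangulatedHull ?_ hX hY f
    rintro _ _ ⟨b, hb, rfl⟩ ⟨c, hc, rfl⟩
    exact hE.exceptional b c (hc.trans_lt hb)
  have hdec : ∀ X, ∃ X', IsComponent P Q X X' := fun X => by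
    have hX : generated E X := by rw [hE.full]; trivial
    refine exists_isComponent hPQ ?_ hX
    rintro _ ⟨b⟩
    rcases lt_or_ge a b with h | h
    · exact Or.inl (.of _ ⟨b, h, rfl⟩)
    · exact Or.inr (.of _ ⟨b, h, rfl⟩)
  have hQ : Q ≤ HomFinite k (E a) := by
    refine HomFinite.of_triangulatedHull k (E a) ?_
    rintro _ ⟨b, hb, rfl⟩
    rcases hb.eq_or_lt with rfl | hb
    · have : Module.Finite k (E b ⟶ E b) :=
        Module.finite_of_finrank_pos (by rw [hE.end_eq]; exact one_pos)
      exact homFinite_of_eq_zero (hE.self_ext b)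
    · have : Subsingleton (E a ⟶ E b) :=
        ⟨fun f g => (hom_zero_shift_eq_zero (hE.exceptional a b hb 0) f).trans
          (hom_zero_shift_eq_zero (hE.exceptional a b hb 0) g).symm⟩
      exact homFinite_of_eq_zero fun l _ => hE.exceptional a b hb l
  obtain ⟨d, hd⟩ := exists_extend_additive hPQ hdec (eulerChar k (E a)) fun T hT h₁ h₂ h₃ =>
    eulerChar_of_distTriang k (E a) hT (hQ _ h₁) (hQ _ h₂) (hQ _ h₃)
  refine ⟨d, fun b => ?_⟩
  rcases lt_trichotomy a b with h | rfl | h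
  · rw [hd _ _ (isComponent_zero (.of _ ⟨b, h, rfl⟩)), if_neg h.ne']
    exact eulerChar_eq_zero fun l f => (Functor.map_isZero _ (isZero_zero C)).eq_of_tgt _ _
  · rw [hd _ _ (isComponent_self (.of _ ⟨a, le_rfl, rfl⟩)), if_pos rfl,
      eulerChar_eq_finrank (hE.self_ext a), hE.end_eq, Nat.cast_one]
  · rw [hd _ _ (isComponent_self (.of _ ⟨b, h.le, rfl⟩)), if_neg h.ne]
    exact eulerChar_eq_zero (hE.exceptional a b h)

lemma exists_isRankFunction [IsTriangulated C] :
    ∃ rk : TriK C →+ (Fin (n + 1) → ℤ), IsRankFunction E rk := by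
  choose d hd using hE.exists_multiplicity
  refine ⟨AddMonoidHom.mk' (fun x a => d a x) fun x y => funext fun a => map_add _ _ _, fun b => ?_⟩
  funext a
  simp [hd, Pi.single_apply, eq_comm]

end IsFullExtExceptional

end Exceptional

/-! ### The heart inside a generated triangulated subcategory. -/

section TriangulatedSubcategory

variable {C : Type u} [Category.{v} C] [Preadditive C] [HasZeroObject C] [HasShift C ℤ]
  [∀ m : ℤ, (shiftFunctor C m).Additive] [Pretriangulated C]

/-- The homomorphism of Grothendieck groups induced by a triangulated functor. -/
def TriK.map {D : Type u'} [Category.{v'} D] [Preadditive D] [HasZeroObject D] [HasShift D ℤ]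
    [∀ m : ℤ, (shiftFunctor D m).Additive] [Pretriangulated D] (F : C ⥤ D) [F.CommShift ℤ]
    [F.IsTriangulated] : TriK C →+ TriK D :=
  QuotientAddGroup.lift (triRelations C) (FreeAbelianGroup.lift fun X => TriK.cls (F.obj X)) (by
    rw [triRelations, AddSubgroup.closure_le]
    rintro _ ⟨T, hT, rfl⟩
    have h : TriK.cls (F.obj T.obj₂) = TriK.cls (F.obj T.obj₁) + TriK.cls (F.obj T.obj₃) :=
      TriK.cls_of_distTriang (F.map_distinguished T hT)
    simp [h])

lemma TriK.map_cls {D : Type u'} [Category.{v'} D] [Preadditive D] [HasZeroObject D]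
    [HasShift D ℤ] [∀ m : ℤ, (shiftFunctor D m).Additive] [Pretriangulated D] (F : C ⥤ D)
    [F.CommShift ℤ] [F.IsTriangulated] (X : C) :
    TriK.map F (TriK.cls X) = TriK.cls (F.obj X) :=
  FreeAbelianGroup.lift_apply_of _ _

variable {P : ObjectProperty C} [P.IsTriangulated]

/-- Two morphisms of a triangulated subcategory are part of a distinguished triangle there if and
only if they are part of one in the ambient category. -/
lemma exists_distTriang_fullSubcategory_iff {X Y Z : P.FullSubcategory} (f : X ⟶ Y) (g : Y ⟶ Z) :
    (∃ h, Triangle.mk f g h ∈ distTriang P.FullSubcategory) ↔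
      ∃ h, Triangle.mk f.hom g.hom h ∈ distTriang C := by
  constructor
  · rintro ⟨h, hT⟩
    exact ⟨_, P.ι.map_distinguished _ hT⟩
  · rintro ⟨h, hT⟩
    refine ⟨homMk (h ≫ (P.ι.commShiftIso (1 : ℤ)).inv.app X), ?_⟩
    change P.ι.mapTriangle.obj _ ∈ distTriang C
    refine distinguished_mk_of_iso hT (Iso.refl _) (Iso.refl _) (Iso.refl _) ?_ ?_ ?_
    · exact (Category.comp_id f.hom).trans (Category.id_comp f.hom).symm
    · exact (Category.comp_id g.hom).trans (Category.id_comp g.hom).symm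
    · have h₁ : (h ≫ (P.ι.commShiftIso (1 : ℤ)).inv.app X) ≫
          (P.ι.commShiftIso (1 : ℤ)).hom.app X = h := by
        rw [Category.assoc, Iso.inv_hom_id_app]
        exact Category.comp_id h
      exact (congrArg₂ CategoryStruct.comp h₁ ((shiftFunctor C (1 : ℤ)).map_id X.obj)).trans
        ((Category.comp_id h).trans (Category.id_comp h).symm)

section Generated

variable {κ : Type w} {R : κ → C}

lemma extensionClosure_le_triangulatedHull (G : ObjectProperty C) :
    extensionClosure G ≤ triangulatedHull G := by
  intro X hX
  induction hX with
  | of X hX => exact .of X hX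
  | zero X hX => exact .zero X hX
  | ext T hT h₁ h₃ ih₁ ih₃ => exact .ext T hT ih₁ ih₃

lemma heart_toGenerated_iff (X : (generated R).FullSubcategory) :
    heart (toGenerated R) X ↔ heart R X.obj := by
  constructor
  · intro h
    induction h with
    | of X hX => obtain ⟨a⟩ := hX; exact .of _ ⟨a⟩
    | zero X hX => exact .zero _ ((isZero_fullSubcategory_iff _ _).1 hX)
    | ext T hT h₁ h₃ ih₁ ih₃ => exact .ext _ ((generated R).ι.map_distinguished T hT) ih₁ ih₃
  · obtain ⟨X, hX'⟩ := X
    intro (h : heart R X)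
    induction h with
    | of X hX => obtain ⟨a⟩ := hX; exact .of _ ⟨a⟩
    | zero X hX => exact .zero _ ((isZero_fullSubcategory_iff _ _).2 hX)
    | ext T hT h₁ h₃ ih₁ ih₃ =>
      have h₁ := extensionClosure_le_triangulatedHull _ _ h₁
      have h₃ := extensionClosure_le_triangulatedHull _ _ h₃
      obtain ⟨h, hT'⟩ := (exists_distTriang_fullSubcategory_iff (P := generated R)
        (X := ⟨_, h₁⟩) (Y := ⟨_, hX'⟩) (Z := ⟨_, h₃⟩) (homMk T.mor₁) (homMk T.mor₂)).2 ⟨_, hT⟩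
      exact .ext _ hT' (ih₁ h₁) (ih₃ h₃)

lemma generated_toGenerated : generated (toGenerated R) = ⊤ := by
  rw [eq_top_iff]
  rintro ⟨X, hX'⟩ -
  have h : generated R X := hX'
  induction h with
  | of X hX => obtain ⟨a⟩ := hX; exact .of _ ⟨a⟩
  | zero X hX => exact .zero _ ((isZero_fullSubcategory_iff _ _).2 hX)
  | shift X a hX ih =>
    refine prop_of_iso _ ?_ (triangulatedHull.shift _ a (ih hX))
    exact (generated R).fullyFaithfulι.preimageIso (((generated R).ι.commShiftIso a).app ⟨X, hX⟩)
  | ext T hT h₁ h₃ ih₁ ih₃ =>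
    obtain ⟨h, hT'⟩ := (exists_distTriang_fullSubcategory_iff (P := generated R)
      (X := ⟨_, h₁⟩) (Y := ⟨_, hX'⟩) (Z := ⟨_, h₃⟩) (homMk T.mor₁) (homMk T.mor₂)).2 ⟨_, hT⟩
    exact .ext _ hT' (ih₁ h₁) (ih₃ h₃)

lemma isSimpleMinded_toGenerated
    (hneg : ∀ (a b : κ) (l : ℤ), l < 0 → ∀ f : R a ⟶ (R b)⟦l⟧, f = 0)
    (hiso : ∀ (a b : κ) (f : R a ⟶ R b), f = 0 ∨ IsIso f) :
    IsSimpleMinded (toGenerated R) where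
  hom_neg a b l hl f := by
    have h := hneg a b l hl (f.hom ≫ ((generated R).ι.commShiftIso l).hom.app (toGenerated R b))
    apply (generated R).ι.map_injective
    rw [← cancel_mono (((generated R).ι.commShiftIso l).hom.app (toGenerated R b)),
      Functor.map_zero, zero_comp]
    exact h
  eq_zero_or_isIso a b f := by
    refine (hiso a b f.hom).imp (fun h => (generated R).ι.map_injective h) fun h => ?_
    have : IsIso ((generated R).ι.map f) := h
    exact isIso_of_reflects_iso f (generated R).ι
  full := generated_toGenerated

end Generated

end TriangulatedSubcategory

/-! ### Restriction to a part of the collection. -/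

section Restriction

variable {C : Type u} [Category.{v} C] [Preadditive C] [HasZeroObject C] [HasShift C ℤ]
  [∀ m : ℤ, (shiftFunctor C m).Additive] [Pretriangulated C] [IsTriangulated C]

/-- Monomorphisms of the heart are the morphisms whose cone belongs to the heart. -/
lemma IsSimpleMinded.mono_iff {ι : Type w} {S : ι → C} (hS : IsSimpleMinded S)
    {X Y : (heart S).FullSubcategory} (f : X ⟶ Y) :
    Mono f ↔ ∃ (Z : C) (_ : heart S Z) (g : Y.obj ⟶ Z) (h : Z ⟶ X.obj⟦(1 : ℤ)⟧),
      Triangle.mk f.hom g h ∈ distTriang C := by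
  let := hS.abelianHeart
  constructor
  · intro hf
    obtain ⟨h, hT⟩ := hS.distTriang_of_shortExact (shortExact_cokernel f)
    exact ⟨_, (cokernel f).property, _, h, hT⟩
  · rintro ⟨Z, hZ, g, h, hT⟩
    obtain ⟨w, h⟩ := hS.shortExact_of_distTriang f (X₃ := ⟨Z, hZ⟩) (homMk g) h hT
    exact h.mono_f

variable {ι : Type w} {κ : Type w'} {S : ι → C} {R : κ → C} {e : κ ↪ ι} (hR : ∀ a, R a = S (e a))
include hR

lemma heart_le_of_embedding : heart R ≤ heart S := by
  refine extensionClosure_mono ?_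
  rintro _ ⟨a⟩
  rw [hR]
  exact ⟨e a⟩

lemma IsSimpleMinded.restrict (hS : IsSimpleMinded S) : IsSimpleMinded (toGenerated R) :=
  isSimpleMinded_toGenerated (fun a b => by rw [hR, hR]; exact hS.hom_neg (e a) (e b))
    (fun a b => by rw [hR, hR]; exact hS.eq_zero_or_isIso (e a) (e b))

variable [DecidableEq ι] [DecidableEq κ] {rk : TriK C →+ (ι → ℤ)} (hrk : IsRankFunction S rk)
include hrk

lemma IsRankFunction.restrict : IsRankFunction (toGenerated R)
    (AddMonoidHom.mk' (fun x a => rk (TriK.map (generated R).ι x) (e a)) fun x y => by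
      funext; simp : TriK (generated R).FullSubcategory →+ (κ → ℤ)) := by
  intro a
  funext b
  change rk (TriK.map (generated R).ι (TriK.cls (toGenerated R a))) (e b) = _
  rw [TriK.map_cls]
  change rk (TriK.cls (R a)) (e b) = _
  rw [hR, hrk]
  simp [Pi.single_apply]

lemma IsRankFunction.eq_zero_of_generated {X : C} (hX : generated R X) {b : ι}
    (hb : b ∉ Set.range e) : rk (TriK.cls X) b = 0 := by
  have h := TriK.hom_ext (generated_toGenerated (R := R))
    (f := ((Pi.evalAddMonoidHom _ b).comp rk).comp (TriK.map (generated R).ι)) (g := 0) fun a => by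
      change rk (TriK.map (generated R).ι (TriK.cls (toGenerated R a))) b = 0
      rw [TriK.map_cls]
      change rk (TriK.cls (R a)) b = 0
      rw [hR, hrk, Pi.single_apply, if_neg]
      rintro rfl
      exact hb ⟨a, rfl⟩
  have := DFunLike.congr_fun h (TriK.cls ⟨X, hX⟩)
  rw [AddMonoidHom.comp_apply, TriK.map_cls] at this
  exact this

/-- Ranks are nonnegative and additive, so if a coordinate vanishes on an extension it vanishes on
both ends. By induction, only members of the part occur. -/
lemma IsRankFunction.heart_of_eq_zero {X : C} (hX : heart S X)
    (h : ∀ b ∉ Set.range e, rk (TriK.cls X) b = 0) : heart R X := by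
  induction hX with
  | of X hX =>
    obtain ⟨a⟩ := hX
    by_cases ha : a ∈ Set.range e
    · obtain ⟨a, rfl⟩ := ha
      rw [← hR]
      exact .of _ ⟨a⟩
    · have := h a ha
      rw [hrk, Pi.single_eq_same] at this
      exact absurd this one_ne_zero
  | zero X hX => exact .zero X hX
  | ext T hT h₁ h₃ ih₁ ih₃ =>
    have h' : ∀ b ∉ Set.range e, rk (TriK.cls T.obj₁) b = 0 ∧ rk (TriK.cls T.obj₃) b = 0 := by
      intro b hb
      have := h b hb
      rw [TriK.cls_of_distTriang hT, map_add, Pi.add_apply] at this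
      have := hrk.nonneg h₁ b
      have := hrk.nonneg h₃ b
      constructor <;> lia
    exact .ext T hT (ih₁ fun b hb => (h' b hb).1) (ih₃ fun b hb => (h' b hb).2)

lemma IsRankFunction.heart_iff {X : C} (hX : generated R X) : heart R X ↔ heart S X :=
  ⟨fun h => heart_le_of_embedding hR X h,
    fun h => hrk.heart_of_eq_zero hR h fun _ hb => hrk.eq_zero_of_generated hR hX hb⟩

/-- The ends of a distinguished triangle in the heart belong to the heart of a part of the
collection if the middle term does. -/
lemma IsRankFunction.heart_of_distTriang {T : Triangle C} (hT : T ∈ distTriang C)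
    (h₁ : heart S T.obj₁) (h₂ : heart R T.obj₂) (h₃ : heart S T.obj₃) :
    heart R T.obj₁ ∧ heart R T.obj₃ := by
  have h' : ∀ b ∉ Set.range e, rk (TriK.cls T.obj₁) b = 0 ∧ rk (TriK.cls T.obj₃) b = 0 := by
    intro b hb
    have := hrk.eq_zero_of_generated hR (extensionClosure_le_triangulatedHull _ _ h₂) hb
    rw [TriK.cls_of_distTriang hT, map_add, Pi.add_apply] at this
    have := hrk.nonneg h₁ b
    have := hrk.nonneg h₃ b
    constructor <;> lia
  exact ⟨hrk.heart_of_eq_zero hR h₁ fun b hb => (h' b hb).1,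
    hrk.heart_of_eq_zero hR h₃ fun b hb => (h' b hb).2⟩

variable (hS : IsSimpleMinded S) (hS' : IsSimpleMinded (toGenerated R)) (Z : TriK C →+ ℂ)

omit [DecidableEq ι] [DecidableEq κ] hR hrk in
lemma phase_toGenerated (X : (heart (toGenerated R)).FullSubcategory) (hX : heart S X.obj.obj) :
    phase (heartCharge hS' (Z.comp (TriK.map (generated R).ι))) X =
      phase (heartCharge hS Z) ⟨X.obj.obj, hX⟩ := by
  rw [phase, phase, heartCharge_cls, heartCharge_cls, AddMonoidHom.comp_apply, TriK.map_cls]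
  rfl

/-- Monomorphisms of either heart are recognised by their cones. A subobject taken in the large
heart, and its cokernel, have no ranks outside the part, so both lie in the small heart and the same
subobjects are tested with the same phases. -/
lemma isSemistable_toGenerated_iff (X : (heart (toGenerated R)).FullSubcategory)
    (hX : heart S X.obj.obj) :
    IsSemistable (heartCharge hS' (Z.comp (TriK.map (generated R).ι))) X ↔
      IsSemistable (heartCharge hS Z) ⟨X.obj.obj, hX⟩ := by
  have h0 : ∀ (Y : (heart (toGenerated R)).FullSubcategory) (hY : heart S Y.obj.obj),
      IsZero Y ↔ IsZero (⟨Y.obj.obj, hY⟩ : (heart S).FullSubcategory) := fun Y hY => by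
    rw [isZero_fullSubcategory_iff, isZero_fullSubcategory_iff, isZero_fullSubcategory_iff]
  have hXR : heart R X.obj.obj := (heart_toGenerated_iff _).1 X.property
  rw [IsSemistable, IsSemistable, ← h0 X hX, ← phase_toGenerated hS hS' Z X hX]
  refine and_congr_right fun _ => ⟨fun h X' f hf hX' => ?_, fun h X' f hf hX' => ?_⟩
  · obtain ⟨Q, hQ, g, δ, hT⟩ := (hS.mono_iff f).1 hf
    obtain ⟨h₁, h₃⟩ := hrk.heart_of_distTriang hR hT X'.property hXR hQ
    let Y : (generated R).FullSubcategory := ⟨_, extensionClosure_le_triangulatedHull _ _ h₁⟩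
    let W : (generated R).FullSubcategory := ⟨_, extensionClosure_le_triangulatedHull _ _ h₃⟩
    obtain ⟨δ', hT'⟩ := (exists_distTriang_fullSubcategory_iff (X := Y) (Y := X.obj) (Z := W)
      (homMk f.hom) (homMk g)).2 ⟨δ, hT⟩
    let Y' : (heart (toGenerated R)).FullSubcategory := ⟨Y, (heart_toGenerated_iff Y).2 h₁⟩
    let f' : Y' ⟶ X := homMk (homMk f.hom)
    have hf' : Mono f' := (hS'.mono_iff f').2 ⟨W, (heart_toGenerated_iff W).2 h₃, _, _, hT'⟩
    have := h Y' f' hf' (by rwa [h0 Y' X'.property])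
    rwa [phase_toGenerated hS hS' Z Y' X'.property] at this
  · obtain ⟨W, hW, g, δ, hT⟩ := (hS'.mono_iff f).1 hf
    obtain ⟨δ', hT'⟩ := (exists_distTriang_fullSubcategory_iff f.hom g).1 ⟨δ, hT⟩
    have h₁ := heart_le_of_embedding hR _ ((heart_toGenerated_iff _).1 X'.property)
    have h₃ := heart_le_of_embedding hR _ ((heart_toGenerated_iff _).1 hW)
    let f' : (⟨X'.obj.obj, h₁⟩ : (heart S).FullSubcategory) ⟶ ⟨X.obj.obj, hX⟩ := homMk f.hom.hom
    have hf' : Mono f' := (hS.mono_iff f').2 ⟨_, h₃, _, _, hT'⟩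
    rw [phase_toGenerated hS hS' Z X' h₁]
    exact h _ f' hf' (by rwa [← h0 X' h₁])

lemma heartSlice_toGenerated_iff (t : ℝ) (X : (generated R).FullSubcategory) :
    heartSlice hS' (Z.comp (TriK.map (generated R).ι)) t X ↔ heartSlice hS Z t X.obj := by
  have h : heart (toGenerated R) X ↔ heart S X.obj :=
    (heart_toGenerated_iff X).trans (hrk.heart_iff hR X.property)
  simp only [heartSlice, isZero_fullSubcategory_iff]
  constructor
  · rintro ⟨hX, h'⟩
    refine ⟨h.1 hX, h'.imp_right ?_⟩
    rw [isSemistable_toGenerated_iff hR hrk hS hS' Z ⟨X, hX⟩ (h.1 hX),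
      phase_toGenerated hS hS' Z ⟨X, hX⟩ (h.1 hX)]
    exact id
  · rintro ⟨hX, h'⟩
    refine ⟨h.2 hX, h'.imp_right ?_⟩
    rw [isSemistable_toGenerated_iff hR hrk hS hS' Z ⟨X, h.2 hX⟩ hX,
      phase_toGenerated hS hS' Z ⟨X, h.2 hX⟩ hX]
    exact id

lemma slicing_toGenerated (hZ : ∀ a, Z (TriK.cls (S a)) ∈ halfPlane) (t : ℝ) :
    slicing hS' (Z.comp (TriK.map (generated R).ι)) t =
      (slicing hS Z t).inverseImage (generated R).ι := by
  ext X
  rw [slicing, heartSlice_toGenerated_iff hR hrk hS hS' Z]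
  let i := ((generated R).ι.commShiftIso (-(⌈t⌉ - 1))).app X
  exact ⟨heartSlice_of_iso hS hZ i, heartSlice_of_iso hS hZ i.symm⟩

omit hR in
lemma IsRankFunction.not_isZero (a : ι) : ¬ IsZero (S a) := by
  intro h
  have := hrk a
  rw [TriK.cls_of_isZero h, map_zero] at this
  exact one_ne_zero (Pi.single_eq_zero_iff.1 this.symm)

omit hR in
lemma IsRankFunction.charge_mem_halfPlane {σ : StabilityCondition C}
    (hσ : σ ∈ collectionFamily S) (a : ι) : σ.Z (TriK.cls (S a)) ∈ halfPlane := by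
  obtain ⟨Z, hZ, -, hσ, -⟩ := hσ
  have := hZ ⟨S a, .of _ ⟨a⟩⟩ (by
    rw [isZero_fullSubcategory_iff]; exact hrk.not_isZero a)
  rwa [← hσ] at this

include hS in
/-- The stability conditions on the heart of a simple-minded collection restrict to those on the
heart of a part of the collection. -/
theorem exists_restriction [Fintype ι] [Fintype κ] :
    ∃ π : collectionFamily S → collectionFamily (toGenerated R),
      (∀ (σ : collectionFamily S) (σ' : collectionFamily (toGenerated R)),
        π σ = σ' ↔ ∀ a, σ'.1.Z (TriK.cls (toGenerated R a)) = σ.1.Z (TriK.cls (S (e a)))) ∧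
      Function.Surjective π ∧
      ∀ (σ : collectionFamily S) (t : ℝ),
        (π σ).1.P t = (σ.1.P t).inverseImage (generated R).ι := by
  have hS' := hS.restrict hR
  have hrk' := hrk.restrict hR
  have hval : ∀ (Z : TriK C →+ ℂ) (a : κ), (Z.comp (TriK.map (generated R).ι))
      (TriK.cls (toGenerated R a)) = Z (TriK.cls (S (e a))) := fun Z a => by
    rw [AddMonoidHom.comp_apply, TriK.map_cls, ← hR]
    rfl
  have hmem : ∀ (σ : collectionFamily S) (a : κ), (σ.1.Z.comp (TriK.map (generated R).ι))
      (TriK.cls (toGenerated R a)) ∈ halfPlane := fun σ a => by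
    rw [hval]
    exact hrk.charge_mem_halfPlane σ.2 (e a)
  let π : collectionFamily S → collectionFamily (toGenerated R) := fun σ =>
    ⟨stabilityOfCharge hS' (hmem σ) hrk', stabilityOfCharge_mem hS' (hmem σ) hrk'⟩
  have hπ : ∀ (σ : collectionFamily S) (σ' : collectionFamily (toGenerated R)),
      π σ = σ' ↔ ∀ a, σ'.1.Z (TriK.cls (toGenerated R a)) = σ.1.Z (TriK.cls (S (e a))) := by
    refine fun σ σ' => ⟨?_, fun h => ?_⟩
    · rintro rfl a
      exact hval σ.1.Z a
    · refine Subtype.ext (eq_of_mem_heartFamily (π σ).2 σ'.2 (TriK.hom_ext hS'.full fun a => ?_))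
      exact (hval σ.1.Z a).trans (h a).symm
  refine ⟨π, hπ, fun σ' => ?_, fun σ t => ?_⟩
  · let c : ι → ℂ := Function.extend e (fun a => σ'.1.Z (TriK.cls (toGenerated R a))) fun _ => -1
    let Z : TriK C →+ ℂ := AddMonoidHom.mk' (fun x => ∑ a, (rk x a : ℂ) * c a) fun x y => by
      simp [Finset.sum_add_distrib, add_mul]
    have hZ : ∀ a, Z (TriK.cls (S a)) = c a := fun a => by
      change ∑ b, (rk (TriK.cls (S a)) b : ℂ) * c b = c a
      rw [hrk a, Finset.sum_eq_single a]
      · simp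
      · intro b _ hab
        simp [hab]
      · simp
    have hc : ∀ a, Z (TriK.cls (S a)) ∈ halfPlane := fun a => by
      rw [hZ]
      by_cases ha : a ∈ Set.range e
      · obtain ⟨a, rfl⟩ := ha
        rw [show c (e a) = _ from e.injective.extend_apply _ _ a]
        exact hrk'.charge_mem_halfPlane σ'.2 a
      · rw [show c a = _ from Function.extend_apply' _ _ a ha, mem_halfPlane_iff']
        simp
    refine ⟨⟨stabilityOfCharge hS hc hrk, stabilityOfCharge_mem hS hc hrk⟩, (hπ _ _).2 fun a => ?_⟩
    exact ((hZ (e a)).trans (e.injective.extend_apply _ _ a)).symm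
  · have hσ := hrk.charge_mem_halfPlane σ.2
    -- By uniqueness `σ` is the constructed condition with its own charge, so comparing the
    -- constructed slicings is enough.
    have h : σ.1 = stabilityOfCharge hS hσ hrk :=
      eq_of_mem_heartFamily σ.2 (stabilityOfCharge_mem hS hσ hrk) rfl
    rw [h]
    exact slicing_toGenerated hR hrk hS hS' σ.1.Z hσ t

end Restriction

end BridgelandStability

theorem mainTheorem11 {k : Type*} [Field k] {C : Type*} [Category* C] [Preadditive C]
    [Linear k C] [HasZeroObject C] [HasShift C ℤ] [∀ m : ℤ, (shiftFunctor C m).Additive]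
    [∀ m : ℤ, (shiftFunctor C m).Linear k] [Pretriangulated C] [IsTriangulated C]
    {n : ℕ} (E : Fin (n + 1) → C) (hE : IsFullExtExceptional k E)
    (i j : Fin (n + 1)) (hij : i < j) :
    ∃ π : collectionFamily E → collectionFamily (toGenerated (subcollection E i j)),
      (∀ (σ : collectionFamily E) (σ' : collectionFamily (toGenerated (subcollection E i j))),
        π σ = σ' ↔ ∀ a : Set.Icc i j,
          σ'.1.Z (TriK.cls (toGenerated (subcollection E i j) a)) = σ.1.Z (TriK.cls (E a))) ∧
      Function.Surjective π ∧
      ∀ (σ : collectionFamily E) (t : ℝ),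
        (π σ).1.P t = (σ.1.P t).inverseImage (generated (subcollection E i j)).ι := by
  obtain ⟨rk, hrk⟩ := hE.exists_isRankFunction
  exact exists_restriction (e := Function.Embedding.subtype _) (fun _ => rfl) hrk
    hE.isSimpleMinded
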